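/- \textbf{Setting.} Let $A_0,A_1,\dots$ be attributes and $\mathrm{Val}$ a set of values. A domain assignment gives each attribute $A_i$ a set of non-null values in $\mathrm{Val}$ with at least two elements; in addition the null symbol $*$ may occur in every column. A relation over a schema $R=\{A_0,\dots,A_{n-1}\}$ is a finite multiset of tuples over $R$ with entries in the respective domains, nulls allowed. A grounding of $r$ is obtained by replacing, in each copy of each tuple independently, all nulls by non-null values of the respective domains. For $X,Y\subseteq R$, a relation $r$ satisfies $X\perp Y$ if all its tuples are free of nulls on $X\cup Y$ and for all $t_1,t_2\in r$ there is $t\in r$ with $t(X)=t_1(X)$ and $t(Y)=t_2(Y)$. It satisfies the certain independence atom (CIA) $X\perp_c Y$ if every grounding of $r$ satisfies $X\perp Y$, and the possible independence atom (PIA) $X\perp_p Y$ if some grounding of $r$ satisfies $X\perp Y$. An atom is disjoint if $X\cap Y=\emptyset$. $\mathrm{PIA}^*$ is the class of PIAs $X\perp_pY$ with $|X|=1$ or $|Y|=1$ or $\bigl||X|-|Y|\bigr|\le 1$. Fix a class $\mathcal D$ of admissible domain assignments that contains at least one assignment in which all domains are finite (for example: all assignments if $\mathrm{Val}$ has at least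 two elements, all assignments with finite domains, or one fixed assignment with finite domains). For a finite set $\Sigma\cup\{\sigma\}$ of atoms over $R$, write $\Sigma\models\sigma$ if every relation over $R$, with domains given by some assignment in $\mathcal D$, that satisfies all atoms of $\Sigma$ also satisfies $\sigma$. An input $(n,\Sigma,\sigma)$ is encoded as a word over a fixed six-letter alphabet: the code of $\sigma$ followed by the codes of the members of $\Sigma$, listed in any order. The code of an atom over $R$ has length $n+1$: one letter for its kind (certain or possible), and then for each of $A_0,\dots,A_{n-1}$ one letter that tells whether the attribute belongs to the left and to the right side of the atom. \textbf{Theorem.} Each of the following three problems is decidable in polynomial time, that is, the set of words that encode an input of the stated form with $\Sigma\models\sigma$ is decided by a deterministic multi-stack Turing machine in a number of steps polynomial in the length of the word: \begin{enumerate} \item the implication problem for CIAs: $\Sigma$ is a finite set of CIAs and $\sigma$ is a CIA; \item the $(\mathrm{PIA},\mathrm{PIA}^*)$-implication problem: $\Sigma$ is a finite set of PIAs and $\sigma$ is in $\mathrm{PIA}^*$; \item the $(\mathrm{CIA}\cup\mathrm{PIA},\mathrm{CIA})$-implication problem for disjoint atoms: $\Sigma$ is a finite set of disjoint CIAs and PIAs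 and $\sigma$ is a disjoint CIA. \end{enumerate} -/

import Mathlib

namespace IncompleteIndependence

/-! ### Relations with nulls, over the schema `{A₀, …, Aₙ₋₁}` -/

section Semantics

variable {Val : Type*} {n : ℕ}

/-- A tuple over the schema `{A₀, …, Aₙ₋₁}`. The set `D i` consists of the non-null values of the
domain of `Aᵢ`, and `none` is the null symbol. -/
abbrev Tuple (D : ℕ → Set Val) (n : ℕ) : Type _ := (i : Fin n) → Option (D i)

/-- A relation is a finite multiset of tuples. -/
abbrev Table (D : ℕ → Set Val) (n : ℕ) : Type _ := Multiset (Tuple D n)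

variable {D : ℕ → Set Val}

/-- `t'` is complete and arises from `t` by replacing the nulls of `t` by non-null values. -/
def TupleGrounding (t t' : Tuple D n) : Prop :=
  ∀ i, t' i ≠ none ∧ (t i ≠ none → t' i = t i)

/-- `r'` arises from `r` by grounding every copy of every tuple independently. -/
def Grounding (r r' : Table D n) : Prop := Multiset.Rel TupleGrounding r r'

/-- The two tuples have the same projection on `X`. -/
def AgreeOn (X : Finset (Fin n)) (t t' : Tuple D n) : Prop := ∀ i ∈ X, t i = t' i

/-- The relation `r` satisfies the independence atom `X ⊥ Y`. -/
def SatIA (r : Table D n) (X Y : Finset (Fin n)) : Prop :=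
  (∀ t ∈ r, ∀ i ∈ X ∪ Y, t i ≠ none) ∧
    ∀ t₁ ∈ r, ∀ t₂ ∈ r, ∃ t ∈ r, AgreeOn X t t₁ ∧ AgreeOn Y t t₂

end Semantics

/-! ### Certain and possible independence atoms and their implication -/

inductive Kind
  | certain
  | possible
  deriving DecidableEq

/-- The atom `X ⊥_c Y` (a CIA) or `X ⊥_p Y` (a PIA) over `{A₀, …, Aₙ₋₁}`. -/
structure Atom (n : ℕ) where
  kind : Kind
  X : Finset (Fin n)
  Y : Finset (Fin n)

/-- Satisfaction: certain means in all groundings, possible means in some grounding. -/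
def Sat {Val : Type*} {D : ℕ → Set Val} {n : ℕ} (r : Table D n) (a : Atom n) : Prop :=
  match a.kind with
  | .certain => ∀ r', Grounding r r' → SatIA r' a.X a.Y
  | .possible => ∃ r', Grounding r r' ∧ SatIA r' a.X a.Y

/-- Logical implication, over all relations whose domains are given by an admissible domain
assignment, that is, a member of `𝒟`. -/
def Implies {Val : Type*} (𝒟 : Set (ℕ → Set Val)) {n : ℕ} (hyps : List (Atom n)) (goal : Atom n) :
    Prop :=
  ∀ D ∈ 𝒟, ∀ r : Table D n, (∀ a ∈ hyps, Sat r a) → Sat r goal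

/-- An input of an implication problem: a schema, a finite set of atoms over it (listed in some
order) and a further atom over it. -/
structure Instance where
  n : ℕ
  hyps : List (Atom n)
  goal : Atom n

/-- Inputs of the implication problem for CIAs. -/
def IsCIA (I : Instance) : Prop :=
  (∀ a ∈ I.hyps, a.kind = .certain) ∧ I.goal.kind = .certain

/-- The class `PIA*`. -/
def Atom.IsPIAStar {n : ℕ} (a : Atom n) : Prop :=
  a.kind = .possible ∧
    ((a.X.card = 1 ∨ a.Y.card = 1) ∨ |(a.X.card : ℤ) - (a.Y.card : ℤ)| ≤ 1)

/-- Inputs of the `(PIA, PIA*)`-implication problem. -/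
def IsPIAPIAStar (I : Instance) : Prop :=
  (∀ a ∈ I.hyps, a.kind = .possible) ∧ I.goal.IsPIAStar

/-- Inputs of the `(CIA ∪ PIA, CIA)`-implication problem restricted to disjoint atoms. -/
def IsDisjointMixedCIA (I : Instance) : Prop :=
  (∀ a ∈ I.hyps, Disjoint a.X a.Y) ∧ Disjoint I.goal.X I.goal.Y ∧ I.goal.kind = .certain

/-! ### Encoding of inputs as words, and polynomial time -/

/-- The input alphabet: the kind of an atom, or one attribute of the schema together with the
information whether it belongs to the left and to the right side of the atom. -/
inductive Sym
  | kind (k : Kind)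
  | attr (inX inY : Bool)
  deriving DecidableEq

/-- An atom over `{A₀, …, Aₙ₋₁}` as a word of length `n + 1`. -/
def encodeAtom {n : ℕ} (a : Atom n) : List Sym :=
  Sym.kind a.kind :: List.ofFn fun i : Fin n => Sym.attr (decide (i ∈ a.X)) (decide (i ∈ a.Y))

def encodeInstance (I : Instance) : List Sym :=
  encodeAtom I.goal ++ I.hyps.flatMap encodeAtom

/-- The language of the implication problem whose inputs are those in `C`: all words that encode
an input in `C` for which the implication holds. -/
def implicationLanguage {Val : Type*} (𝒟 : Set (ℕ → Set Val)) (C : Instance → Prop) :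
    Set (List Sym) :=
  {w | ∃ I : Instance, C I ∧ Implies 𝒟 I.hyps I.goal ∧ encodeInstance I = w}

open Classical in
/-- The language is decided, on all words, by a (multi-stack) Turing machine within a number of
steps that is polynomial in the length of the word. -/
def InPolynomialTime (L : Set (List Sym)) : Prop :=
  Nonempty (Turing.TM2ComputableInPolyTime (id : List Sym → List Sym) Computability.encodeBool
    (fun w => decide (w ∈ L)))

end IncompleteIndependence

/-!
Each of the three implications is governed by a combinatorial criterion that can be tested by going
through the atoms again and again with a bounded amount of information per attribute.

*Certain goals.* An attribute on both sides of a certain hypothesis is constant. Call the other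
attributes of the goal free. Start with the block of all free attributes. As long as a certain
hypothesis covers the block and both of its sides meet it, keep only the part on one side, chosen so
that it meets the left side of the goal. By the exchange rule (`Ind.split`) the block stays
independent of the rest of the free attributes. A final block that misses the right side of the goal
can be removed from the left side (`Ind.of_sdiff`), and the process starts again. A final block that
meets both sides refutes the implication. If it contains a common attribute of the two sides, two
tuples suffice (`not_implies_of_common`); otherwise (`not_implies_of_block`), over finite domains, take all
tuples on the block but one, and a further tuple that is null on the block. On attributes that do
not include the whole block all combinations of values are present in every grounding, so the
certain hypotheses hold; filling in the missing tuple makes the possible ones true; and a grounding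
that does not fill it in violates the goal. In particular, disjoint possible hypotheses have no
influence on certain goals.

*Possible goals.* Now let the attributes on both sides of some possible hypothesis be the constants.
The implication holds if and only if the common attributes of the goal are constant and, up to
constants, the goal has an empty side or its sides lie on different sides of a single hypothesis
(`implies_possible_iff`). The counterexample for the converse (`not_implies_of_not_covers`) provides
just one null tuple too few for the product that the goal requires, while every hypothesis that
does not separate the goal manages with fewer tuples. The criterion is valid for all possible atoms;
the restriction to `PIA*` only demands a comparison of the sizes of the two sides.

*Time.* Both criteria are written as sweep programs (`certainProgram`, `possibleProgram`), which
keep finitely many bits for each attribute and a finite mode. Polynomially many sweeps suffice: each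
sweep makes the current block or the left side smaller (`certain_run`), or removes one element from
each side that is compared (`possible_run_cancel`). A stack machine executes any sweep program, with
the cells of the attributes on two stacks and the input word on two more
(`SweepProgram.inPolynomialTime`). It rejects the words that encode no input, which are those that
do not start with a kind letter and those with blocks of different lengths (`word_cases`).
-/

namespace IncompleteIndependence

/-! ### Sweep programs -/

/-- The registers of a sweep program that record whether some attribute passes a test. -/
abbrev Flags := Fin 4 → Bool

/-- A sweep program works on a row of cells, one for each attribute of the schema, and on a mode.
It runs over the atoms of the input, the goal first, again and again. While it runs over an atom,
`start` sees the kind of the atom, `test` is evaluated at each attribute (from its cell and its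
membership in the two sides) and its values are joined into the flags, and `write` changes the cell
in view of the flags raised by the attributes to the left. Once the flags are complete, `settle`
changes the mode and `update` changes all cells. After the last atom, `finish` returns an answer or
the mode for the next sweep. -/
structure SweepProgram (Mode Cell : Type) where
  init : Mode
  blank : Cell
  start : Mode → Kind → Mode
  test : Mode → Cell → Bool → Bool → Flags
  write : Mode → Flags → Cell → Bool → Bool → Cell
  settle : Mode → Flags → Mode
  update : Mode → Flags → Cell → Cell
  finish : Mode → Mode ⊕ Bool

namespace SweepProgram

variable {Mode Cell : Type} (P : SweepProgram Mode Cell) {n : ℕ}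

/-- The flags raised by the attributes `A₀, …, Aₘ₋₁`. -/
def flagsBelow (μ : Mode) (ρ : Fin n → Cell) (α : Fin n → Bool × Bool) (m : ℕ) : Flags :=
  fun j => decide (∃ i : Fin n, i.val < m ∧ P.test μ (ρ i) (α i).1 (α i).2 j = true)

theorem flagsBelow_all (μ : Mode) (ρ : Fin n → Cell) (α : Fin n → Bool × Bool) (j : Fin 4) :
    P.flagsBelow μ ρ α n j = decide (∃ i, P.test μ (ρ i) (α i).1 (α i).2 j = true) := by
  simp [flagsBelow]

/-- The two membership bits of each attribute. -/
def bits (a : Atom n) : Fin n → Bool × Bool :=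
  fun i => (decide (i ∈ a.X), decide (i ∈ a.Y))

/-- The effect of running over one atom. -/
def atomStep (s : Mode × (Fin n → Cell)) (a : Atom n) : Mode × (Fin n → Cell) :=
  let μ := P.start s.1 a.kind
  let fl := P.flagsBelow μ s.2 (bits a) n
  let ν := P.settle μ fl
  (ν, fun i => P.update ν fl
    (P.write μ (P.flagsBelow μ s.2 (bits a) i) (s.2 i) (bits a i).1 (bits a i).2))

/-- The effect of running over all atoms once. -/
def sweep (atoms : List (Atom n)) (s : Mode × (Fin n → Cell)) : Mode × (Fin n → Cell) :=
  atoms.foldl P.atomStep s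

/-- The answer given within `k` sweeps, if any. -/
def run (atoms : List (Atom n)) : ℕ → Mode × (Fin n → Cell) → Option Bool
  | 0, _ => none
  | k + 1, s =>
    match P.finish (P.sweep atoms s).1 with
    | .inl μ => run atoms k (μ, (P.sweep atoms s).2)
    | .inr b => some b

/-- The pass from left to right over the cells and the attributes of one atom. -/
def forward (μ : Mode) : Flags → List Cell → List (Bool × Bool) → Flags × List Cell
  | fl, c :: R, a :: u =>
    let r := forward μ (fun j => fl j || P.test μ c a.1 a.2 j) R u
    (r.1, P.write μ fl c a.1 a.2 :: r.2)
  | fl, _, _ => (fl, [])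

/-- A single pass with a list of cells at hand computes flags and cells as in `atomStep`. -/
theorem forward_ofFn (μ : Mode) (fl : Flags) (ρ : Fin n → Cell) (α : Fin n → Bool × Bool) :
    P.forward μ fl (List.ofFn ρ) (List.ofFn α) =
      (fun j => fl j || P.flagsBelow μ ρ α n j,
        List.ofFn fun i =>
          P.write μ (fun j => fl j || P.flagsBelow μ ρ α i j) (ρ i) (α i).1 (α i).2) := by
  induction n generalizing fl with
  | zero => simp [forward, flagsBelow]
  | succ n ih =>
    have key : ∀ m j, P.flagsBelow μ ρ α (m + 1) j =
        (P.test μ (ρ 0) (α 0).1 (α 0).2 j ||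
          P.flagsBelow μ (fun i => ρ i.succ) (fun i => α i.succ) m j) := by
      intro m j
      rw [Bool.eq_iff_iff]
      simp [flagsBelow, Fin.exists_fin_succ]
    have key0 : P.flagsBelow μ ρ α 0 = fun _ => false := by
      funext j; simp [flagsBelow]
    rw [List.ofFn_succ, List.ofFn_succ, List.ofFn_succ, forward, ih]
    simp [key, key0, Bool.or_assoc]

end SweepProgram

/-! ### Words and blocks -/

/-- The letter of an attribute with given membership bits. -/
def attrSym (a : Bool × Bool) : Sym := Sym.attr a.1 a.2

/-- The letter stands for an attribute, not for a kind. -/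
def Sym.isAttr : Sym → Bool
  | .kind _ => false
  | .attr _ _ => true

/-- A kind letter followed by attribute letters. -/
def encodeBlock (b : Kind × List (Bool × Bool)) : List Sym := Sym.kind b.1 :: b.2.map attrSym

theorem encodeAtom_eq_encodeBlock {n : ℕ} (a : Atom n) :
    encodeAtom a = encodeBlock (a.kind, List.ofFn (SweepProgram.bits a)) := by
  simp [encodeAtom, encodeBlock, List.map_ofFn, attrSym, SweepProgram.bits, Function.comp_def]

theorem exists_atom_encodeBlock {n : ℕ} (b : Kind × List (Bool × Bool)) (hb : b.2.length = n) :
    ∃ a : Atom n, encodeBlock b = encodeAtom a := by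
  subst hb
  refine ⟨⟨b.1, Finset.univ.filter fun i => (b.2.get i).1, Finset.univ.filter fun i => (b.2.get i).2⟩, ?_⟩
  rw [encodeAtom_eq_encodeBlock]
  congr 1
  refine Prod.ext rfl (List.ext_get (by simp) ?_)
  intro i h₁ h₂
  simp [SweepProgram.bits]

/-- The number of attribute letters in front of the word, and the numbers of attribute letters that
follow the kind letters. -/
def blockLengths : List Sym → ℕ × List ℕ
  | [] => (0, [])
  | .kind _ :: w => (0, (blockLengths w).1 :: (blockLengths w).2)
  | .attr _ _ :: w => ((blockLengths w).1 + 1, (blockLengths w).2)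

theorem blockLengths_map_attrSym_append (u : List (Bool × Bool)) (w : List Sym) :
    blockLengths (u.map attrSym ++ w) = (u.length + (blockLengths w).1, (blockLengths w).2) := by
  induction u with
  | nil => simp
  | cons a u ih => simp [attrSym, blockLengths, ih]; omega

theorem blockLengths_flatMap (bs : List (Kind × List (Bool × Bool))) :
    blockLengths (bs.flatMap encodeBlock) = (0, bs.map fun b => b.2.length) := by
  induction bs with
  | nil => rfl
  | cons b bs ih =>
    simp [encodeBlock, blockLengths, blockLengths_map_attrSym_append, ih]

theorem exists_blocks (w : List Sym) : ∃ (u : List (Bool × Bool)) (bs : List _),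
    w = u.map attrSym ++ bs.flatMap encodeBlock := by
  induction w with
  | nil => exact ⟨[], [], rfl⟩
  | cons s w ih =>
    obtain ⟨u, bs, rfl⟩ := ih
    cases s with
    | kind k => exact ⟨[], (k, u) :: bs, by simp [encodeBlock]⟩
    | attr x y => exact ⟨(x, y) :: u, bs, by simp [attrSym]⟩

theorem blockLengths_encodeInstance (I : Instance) :
    blockLengths (encodeInstance I) = (0, (I.goal :: I.hyps).map fun _ => I.n) := by
  have : encodeInstance I = ((I.goal :: I.hyps).map fun a =>
      (a.kind, List.ofFn (SweepProgram.bits a))).flatMap encodeBlock := by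
    simp [encodeInstance, List.flatMap_map, ← encodeAtom_eq_encodeBlock]
  rw [this, blockLengths_flatMap, List.map_map]
  simp [Function.comp_def]

theorem encodeAtom_length {n : ℕ} (a : Atom n) : (encodeAtom a).length = n + 1 := by
  simp [encodeAtom]

theorem encodeAtom_injective {n : ℕ} : Function.Injective (encodeAtom (n := n)) := by
  rintro ⟨k, X, Y⟩ ⟨k', X', Y'⟩ h
  simp only [encodeAtom, List.cons.injEq, Sym.kind.injEq] at h
  have h2 := List.ofFn_injective h.2
  have h3 : ∀ i, (i ∈ X ↔ i ∈ X') ∧ (i ∈ Y ↔ i ∈ Y') := by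
    intro i
    have := congrFun h2 i
    simpa using this
  simp only [Atom.mk.injEq]
  exact ⟨h.1, Finset.ext fun i => (h3 i).1, Finset.ext fun i => (h3 i).2⟩

theorem flatMap_encodeAtom_injective {n : ℕ} :
    Function.Injective fun l : List (Atom n) => l.flatMap encodeAtom := by
  intro l
  induction l with
  | nil =>
    intro l' h
    cases l' with
    | nil => rfl
    | cons a l' => simp [encodeAtom] at h
  | cons a l ih =>
    intro l' h
    cases l' with
    | nil => simp [encodeAtom] at h
    | cons a' l' =>
      simp only [List.flatMap_cons] at h
      obtain ⟨h1, h2⟩ := List.append_inj h (by simp [encodeAtom_length])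
      rw [encodeAtom_injective h1, ih h2]

/-- The lengths of the blocks determine `n`, also when there are no attributes or no hypotheses. -/
theorem encodeInstance_injective : Function.Injective encodeInstance := by
  intro I J h
  have h1 := congrArg blockLengths h
  simp only [blockLengths_encodeInstance, List.map_cons, Prod.mk.injEq, List.cons.injEq] at h1
  obtain ⟨n, hI, gI⟩ := I
  obtain ⟨m, hJ, gJ⟩ := J
  obtain rfl : n = m := h1.2.1
  have := @flatMap_encodeAtom_injective n (gI :: hI) (gJ :: hJ) (by simpa [encodeInstance] using h)
  simp only [List.cons.injEq] at this
  rw [this.1, this.2]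

theorem encodeInstance_mem_implicationLanguage {Val : Type*} {𝒟 : Set (ℕ → Set Val)}
    {C : Instance → Prop} {I : Instance} :
    encodeInstance I ∈ implicationLanguage 𝒟 C ↔ C I ∧ Implies 𝒟 I.hyps I.goal := by
  constructor
  · rintro ⟨J, h₁, h₂, h₃⟩
    obtain rfl := encodeInstance_injective h₃
    exact ⟨h₁, h₂⟩
  · exact fun h => ⟨I, h.1, h.2, rfl⟩

/-! ### A stack machine that executes sweep programs -/

/-- The stacks of the machine: the unread and the read part of the input word, the cells to the
right and to the left of the current attribute, and the output. -/
inductive Stk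
  | unread
  | read
  | right
  | left
  | out
  deriving DecidableEq

instance : Fintype Stk where
  elems := {.unread, .read, .right, .left, .out}
  complete k := by cases k <;> decide

/-- The labels of the machine; `code` explains what happens at each of them. -/
inductive Lab
  | first
  | build
  | rewind
  | next
  | fwd
  | bwd
  | clean
  deriving DecidableEq

instance : Fintype Lab where
  elems := {.first, .build, .rewind, .next, .fwd, .bwd, .clean}
  complete l := by cases l <;> decide

/-- The letters on each stack. -/
abbrev Letter (Cell : Type) : Stk → Type
  | .unread => Sym
  | .read => Sym
  | .right => Cell
  | .left => Cell
  | .out => Bool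

/-- The internal state: mode and flags of the program, the letters popped last, and the answer. -/
structure Reg (Mode Cell : Type) where
  mode : Mode
  fl : Flags
  sym : Option Sym
  cell : Option Cell
  ans : Bool

instance : Fintype Sym where
  elems := {.kind .certain, .kind .possible, .attr true true, .attr true false, .attr false true,
    .attr false false}
  complete s := by
    rcases s with (_ | _) | ⟨_ | _, _ | _⟩ <;> decide

noncomputable instance {Mode Cell : Type} [Fintype Mode] [Fintype Cell] :
    Fintype (Reg Mode Cell) :=
  Fintype.ofInjective
    (fun r => (r.mode, r.fl, r.sym, r.cell, r.ans) :
      Reg Mode Cell → Mode × Flags × Option Sym × Option Cell × Bool)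
    (by rintro ⟨⟩ ⟨⟩ h; simpa using h)

variable {Mode Cell : Type}

/-- The contents of all stacks. -/
def stk (i d : List Sym) (r l : List Cell) (o : List Bool) : (k : Stk) → List (Letter Cell k)
  | .unread => i
  | .read => d
  | .right => r
  | .left => l
  | .out => o

section
variable (i d : List Sym) (r l : List Cell) (o : List Bool)

@[simp] theorem stk_unread : stk i d r l o .unread = i := rfl
@[simp] theorem stk_read : stk i d r l o .read = d := rfl
@[simp] theorem stk_right : stk i d r l o .right = r := rfl
@[simp] theorem stk_left : stk i d r l o .left = l := rfl
@[simp] theorem stk_out : stk i d r l o .out = o := rfl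

@[simp] theorem update_stk_unread (x : List Sym) :
    Function.update (stk i d r l o) .unread x = stk x d r l o := by
  funext k; cases k <;> rfl
@[simp] theorem update_stk_read (x : List Sym) :
    Function.update (stk i d r l o) .read x = stk i x r l o := by
  funext k; cases k <;> rfl
@[simp] theorem update_stk_right (x : List Cell) :
    Function.update (stk i d r l o) .right x = stk i d x l o := by
  funext k; cases k <;> rfl
@[simp] theorem update_stk_left (x : List Cell) :
    Function.update (stk i d r l o) .left x = stk i d r x o := by
  funext k; cases k <;> rfl
@[simp] theorem update_stk_out (x : List Bool) :
    Function.update (stk i d r l o) .out x = stk i d r l x := by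
  funext k; cases k <;> rfl

end

/-- The kind given by a kind letter (an arbitrary one for other letters). -/
def Sym.toKind : Sym → Kind
  | .kind k => k
  | .attr _ _ => .certain

/-- The bits given by an attribute letter (arbitrary ones for other letters). -/
def Sym.toBits : Sym → Bool × Bool
  | .kind _ => (false, false)
  | .attr x y => (x, y)

/-- A statement of the machine. -/
abbrev MStmt (Mode Cell : Type) := Turing.TM2.Stmt (Letter Cell) Lab (Reg Mode Cell)

namespace Reg

/-- The input letter popped last exists and is a kind letter. -/
def isKind (ρ : Reg Mode Cell) : Bool := ρ.sym.any fun s => !s.isAttr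

/-- The input letter popped last exists and is an attribute letter. -/
def isAttr (ρ : Reg Mode Cell) : Bool := ρ.sym.any Sym.isAttr

/-- The input letter popped last, with an arbitrary value if there was none. -/
def theSym (ρ : Reg Mode Cell) : Sym := ρ.sym.getD (.kind .certain)

end Reg

namespace SweepProgram

open Turing.TM2.Stmt

variable (P : SweepProgram Mode Cell)

/-- Reject, emptying the stacks. -/
def reject : MStmt Mode Cell := load (fun ρ => { ρ with ans := false }) (goto fun _ => .clean)

/-- The code of the machine. It checks that the word starts with a kind letter (`first`), puts one
blank cell on the stack for each attribute letter of the first block (`build`) and goes back to the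
start of the word (`rewind`). Then it processes the blocks one by one: it reads the kind letter
(`next`), runs over the attributes from left to right (`fwd`) and over the cells from right to left
(`bwd`). A block of a length different from the first one leads to rejection. At the end all stacks
are emptied (`clean`). -/
def code : Lab → MStmt Mode Cell
  | .first =>
    pop .unread (fun ρ s => { ρ with sym := s }) <|
    branch Reg.isKind
      (push .read Reg.theSym <| goto fun _ => .build)
      reject
  | .build =>
    pop .unread (fun ρ s => { ρ with sym := s }) <|
    branch Reg.isAttr
      (push .read Reg.theSym <| push .right (fun _ => P.blank) <| goto fun _ => .build) <|
    branch Reg.isKind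
      (push .unread Reg.theSym <| goto fun _ => .rewind)
      (goto fun _ => .rewind)
  | .rewind =>
    pop .read (fun ρ s => { ρ with sym := s }) <|
    branch (fun ρ => ρ.sym.isSome)
      (push .unread Reg.theSym <| goto fun _ => .rewind)
      (goto fun _ => .next)
  | .next =>
    pop .unread (fun ρ s => { ρ with sym := s }) <|
    branch Reg.isKind
      (push .read Reg.theSym <|
        load (fun ρ => { ρ with
          mode := P.start ρ.mode ρ.theSym.toKind
          fl := fun _ => false }) <|
        goto fun _ => .fwd) <|
    branch Reg.isAttr reject <|
    branch (fun ρ => (P.finish ρ.mode).isLeft)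
      (load (fun ρ => { ρ with mode := (P.finish ρ.mode).elim id fun _ => ρ.mode }) <|
        goto fun _ => .rewind)
      (load (fun ρ => { ρ with ans := (P.finish ρ.mode).elim (fun _ => false) id }) <|
        goto fun _ => .clean)
  | .fwd =>
    pop .unread (fun ρ s => { ρ with sym := s }) <|
    pop .right (fun ρ c => { ρ with cell := c }) <|
    branch (fun ρ => ρ.isAttr && ρ.cell.isSome)
      (push .read Reg.theSym <|
        push .left (fun ρ => P.write ρ.mode ρ.fl (ρ.cell.getD P.blank)
          ρ.theSym.toBits.1 ρ.theSym.toBits.2) <|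
        load (fun ρ => { ρ with
          fl := fun j => ρ.fl j || P.test ρ.mode (ρ.cell.getD P.blank)
            ρ.theSym.toBits.1 ρ.theSym.toBits.2 j }) <|
        goto fun _ => .fwd) <|
    branch (fun ρ => ρ.isAttr || ρ.cell.isSome) reject <|
    load (fun ρ => { ρ with mode := P.settle ρ.mode ρ.fl }) <|
    branch Reg.isKind
      (push .unread Reg.theSym <| goto fun _ => .bwd)
      (goto fun _ => .bwd)
  | .bwd =>
    pop .left (fun ρ c => { ρ with cell := c }) <|
    branch (fun ρ => ρ.cell.isSome)
      (push .right (fun ρ => P.update ρ.mode ρ.fl (ρ.cell.getD P.blank)) <| goto fun _ => .bwd)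
      (goto fun _ => .next)
  | .clean =>
    pop .unread (fun ρ s => { ρ with sym := s }) <|
    branch (fun ρ => ρ.sym.isSome) (goto fun _ => .clean) <|
    pop .read (fun ρ s => { ρ with sym := s }) <|
    branch (fun ρ => ρ.sym.isSome) (goto fun _ => .clean) <|
    pop .right (fun ρ c => { ρ with cell := c }) <|
    branch (fun ρ => ρ.cell.isSome) (goto fun _ => .clean) <|
    pop .left (fun ρ c => { ρ with cell := c }) <|
    branch (fun ρ => ρ.cell.isSome) (goto fun _ => .clean) <|
    push .out Reg.ans <|
    load (fun _ => ⟨P.init, fun _ => false, none, none, false⟩) halt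

/-- The machine that executes a sweep program. -/
noncomputable def machine [Fintype Mode] [Fintype Cell] : Turing.FinTM2 where
  K := Stk
  k₀ := .unread
  k₁ := .out
  Γ := Letter Cell
  Λ := Lab
  main := .first
  σ := Reg Mode Cell
  initialState := ⟨P.init, fun _ => false, none, none, false⟩
  Γk₀Fin := inferInstanceAs (Fintype Sym)
  m := P.code

/-- A configuration of the machine. -/
abbrev MCfg (Mode Cell : Type) := Turing.TM2.Cfg (Letter Cell) Lab (Reg Mode Cell)

/-- The machine gets from the first configuration to the second one in at most `t` steps. -/
def Reach (t : ℕ) (c c' : MCfg Mode Cell) : Prop :=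
  ∃ k ≤ t, (flip bind (Turing.TM2.step P.code))^[k] (some c) = some c'

variable {P}

theorem Reach.refl (t : ℕ) (c : MCfg Mode Cell) : P.Reach t c c := ⟨0, by omega, rfl⟩

theorem Reach.trans {s t : ℕ} {c c' c'' : MCfg Mode Cell} (h : P.Reach s c c')
    (h' : P.Reach t c' c'') : P.Reach (s + t) c c'' := by
  obtain ⟨k, hk, e⟩ := h
  obtain ⟨m, hm, e'⟩ := h'
  exact ⟨m + k, by omega, by rw [Function.iterate_add_apply, e, e']⟩

theorem Reach.mono {s t : ℕ} {c c' : MCfg Mode Cell} (h : P.Reach s c c') (hst : s ≤ t) :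
    P.Reach t c c' := by
  obtain ⟨k, hk, e⟩ := h
  exact ⟨k, by omega, e⟩

/-- Prefix one step, which runs the code at the current label. -/
theorem Reach.head {t : ℕ} {c c'' : MCfg Mode Cell} {l : Lab} {v : Reg Mode Cell}
    {S : (k : Stk) → List (Letter Cell k)} (hc : c = ⟨some l, v, S⟩)
    (h : P.Reach t (Turing.TM2.stepAux (P.code l) v S) c'') : P.Reach (t + 1) c c'' := by
  subst hc
  obtain ⟨k, hk, e⟩ := h
  exact ⟨k + 1, by omega, by rw [Function.iterate_succ_apply]; exact e⟩

/-- A configuration with empty output. -/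
def cfg (l : Lab) (v : Reg Mode Cell) (i d : List Sym) (r l' : List Cell) : MCfg Mode Cell :=
  ⟨some l, v, stk i d r l' []⟩

variable (P) in
/-- The final configuration with the given answer. -/
def final (b : Bool) : MCfg Mode Cell :=
  ⟨none, ⟨P.init, fun _ => false, none, none, false⟩, stk [] [] [] [] [b]⟩

theorem reach_clean (i d : List Sym) (r l : List Cell) (v : Reg Mode Cell) :
    P.Reach (i.length + d.length + r.length + l.length + 1) (cfg .clean v i d r l)
      (P.final v.ans) := by
  induction i generalizing v with
  | cons s i ih =>
    refine (Reach.head rfl (t := i.length + d.length + r.length + l.length + 1) ?_).mono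
      (by simp only [List.length_cons]; omega)
    simpa [code, cfg] using ih { v with sym := some s }
  | nil =>
  induction d generalizing v with
  | cons s d ih =>
    refine (Reach.head rfl (t := d.length + r.length + l.length + 1) ?_).mono
      (by simp only [List.length_cons, List.length_nil]; omega)
    simpa [code, cfg] using ih { v with sym := some s }
  | nil =>
  induction r generalizing v with
  | cons s d ih =>
    refine (Reach.head rfl (t := d.length + l.length + 1) ?_).mono
      (by simp only [List.length_cons, List.length_nil]; omega)
    simpa [code, cfg] using ih { v with sym := none, cell := some s }
  | nil =>
  induction l generalizing v with
  | cons s d ih =>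
    refine (Reach.head rfl (t := d.length + 1) ?_).mono
      (by simp only [List.length_cons, List.length_nil]; omega)
    simpa [code, cfg] using ih { v with sym := none, cell := some s }
  | nil =>
    refine Reach.head rfl ?_
    simpa [code, cfg, final] using Reach.refl _ _

theorem reach_rewind (i d : List Sym) (r l : List Cell) (v : Reg Mode Cell) :
    P.Reach (d.length + 1) (cfg .rewind v i d r l)
      (cfg .next { v with sym := none } (d.reverse ++ i) [] r l) := by
  induction d generalizing v i with
  | nil =>
    refine Reach.head rfl ?_
    simpa [code, cfg] using Reach.refl _ _
  | cons s d ih =>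
    refine Reach.head rfl ?_
    simpa [code, cfg, Reg.theSym] using ih (s :: i) { v with sym := some s }

theorem reach_bwd (i d : List Sym) (r l : List Cell) (v : Reg Mode Cell) :
    P.Reach (l.length + 1) (cfg .bwd v i d r l)
      (cfg .next { v with cell := none } i d ((l.map (P.update v.mode v.fl)).reverse ++ r) []) := by
  induction l generalizing v r with
  | nil =>
    refine Reach.head rfl ?_
    simpa [code, cfg] using Reach.refl _ _
  | cons s d ih =>
    refine Reach.head rfl ?_
    simpa [code, cfg] using ih (P.update v.mode v.fl s :: r) { v with cell := some s }

/-- The word is empty or starts with a kind letter. -/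
def StartsKind (w : List Sym) : Prop := ∀ s ∈ w.head?, s.isAttr = false

theorem startsKind_flatMap (bs : List (Kind × List (Bool × Bool))) :
    StartsKind (bs.flatMap encodeBlock) := by
  cases bs <;> simp [StartsKind, encodeBlock, Sym.isAttr]

theorem reach_build (u : List (Bool × Bool)) (w d : List Sym) (hw : StartsKind w) (r : List Cell)
    (v : Reg Mode Cell) : ∃ s, P.Reach (u.length + 1) (cfg .build v (u.map attrSym ++ w) d r [])
      (cfg .rewind { v with sym := s } w ((u.map attrSym).reverse ++ d)
        (List.replicate u.length P.blank ++ r) []) := by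
  induction u generalizing v r d with
  | nil =>
    cases w with
    | nil =>
      refine ⟨none, Reach.head rfl ?_⟩
      simpa [code, cfg, Reg.isAttr, Reg.isKind] using Reach.refl _ _
    | cons a w =>
      have ha : a.isAttr = false := hw a (by simp)
      refine ⟨some a, Reach.head rfl ?_⟩
      simpa [code, cfg, Reg.isAttr, Reg.isKind, ha, Reg.theSym] using Reach.refl _ _
  | cons a u ih =>
    obtain ⟨s, h⟩ := ih (attrSym a :: d) (P.blank :: r) { v with sym := some (attrSym a) }
    refine ⟨s, Reach.head rfl ?_⟩
    have e : List.replicate u.length P.blank ++ P.blank :: r =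
        List.replicate (u.length + 1) P.blank ++ r := by
      simp [List.replicate_succ']
    rw [e] at h
    simpa [code, cfg, Reg.isAttr, Reg.theSym, attrSym, Sym.isAttr] using h

theorem reach_fwd (u : List (Bool × Bool)) (w d : List Sym) (hw : StartsKind w) (r l : List Cell)
    (hr : r.length = u.length) (v : Reg Mode Cell) :
    ∃ s, P.Reach (u.length + 1) (cfg .fwd v (u.map attrSym ++ w) d r l)
      (cfg .bwd ⟨P.settle v.mode (P.forward v.mode v.fl r u).1, (P.forward v.mode v.fl r u).1,
        s, none, v.ans⟩ w
        ((u.map attrSym).reverse ++ d) [] ((P.forward v.mode v.fl r u).2.reverse ++ l)) := by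
  induction u generalizing v r d l with
  | nil =>
    obtain rfl : r = [] := by simpa using hr
    cases w with
    | nil =>
      refine ⟨none, Reach.head rfl ?_⟩
      simpa [code, cfg, Reg.isAttr, Reg.isKind, forward] using Reach.refl _ _
    | cons a w =>
      have ha : a.isAttr = false := hw a (by simp)
      refine ⟨some a, Reach.head rfl ?_⟩
      simpa [code, cfg, Reg.isAttr, Reg.isKind, ha, Reg.theSym, forward] using Reach.refl _ _
  | cons a u ih =>
    cases r with
    | nil => simp at hr
    | cons c r =>
      obtain ⟨s, h⟩ := ih (attrSym a :: d) r (P.write v.mode v.fl c a.1 a.2 :: l) (by simpa using hr)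
        ⟨v.mode, fun j => v.fl j || P.test v.mode c a.1 a.2 j, some (attrSym a), some c, v.ans⟩
      refine ⟨s, Reach.head rfl ?_⟩
      simpa [code, cfg, Reg.isAttr, Reg.theSym, attrSym, Sym.isAttr, Sym.toBits, forward] using h

/-- A block whose length differs from the number of cells is rejected. -/
theorem reach_fwd_mismatch (u : List (Bool × Bool)) (w d : List Sym) (hw : StartsKind w)
    (r l : List Cell) (hr : r.length ≠ u.length) (v : Reg Mode Cell) :
    P.Reach (2 * u.length + w.length + d.length + r.length + l.length + 2)
      (cfg .fwd v (u.map attrSym ++ w) d r l) (P.final false) := by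
  induction u generalizing v r d l with
  | nil =>
    cases r with
    | nil => simp at hr
    | cons c r =>
    cases w with
    | nil =>
      have := reach_clean (P := P) [] d r l ⟨v.mode, v.fl, none, some c, false⟩
      refine (Reach.head rfl (c'' := P.final false)
        (t := d.length + r.length + l.length + 1) ?_).mono
        (by simp only [List.length_cons, List.length_nil]; omega)
      simpa [code, cfg, Reg.isAttr, reject] using this
    | cons a w =>
      have ha : a.isAttr = false := hw a (by simp)
      have := (reach_clean (P := P) w d r l ⟨v.mode, v.fl, some a, some c, false⟩)
      refine (Reach.head rfl (c'' := P.final false)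
        (t := w.length + d.length + r.length + l.length + 1) ?_).mono (by simp; omega)
      simpa [code, cfg, Reg.isAttr, ha, reject] using this
  | cons a u ih =>
    cases r with
    | nil =>
      have := (reach_clean (P := P) (u.map attrSym ++ w) d [] l
        ⟨v.mode, v.fl, some (attrSym a), none, false⟩)
      refine (Reach.head rfl (c'' := P.final false)
        (t := u.length + w.length + d.length + l.length + 1) ?_).mono (by simp; omega)
      simpa [code, cfg, Reg.isAttr, attrSym, Sym.isAttr, reject] using this
    | cons c r =>
      have h := ih (attrSym a :: d) r (P.write v.mode v.fl c a.1 a.2 :: l) (by simpa using hr)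
        ⟨v.mode, fun j => v.fl j || P.test v.mode c a.1 a.2 j, some (attrSym a), some c, v.ans⟩
      refine (Reach.head rfl (c'' := P.final false) (t := 2 * u.length + w.length + (d.length + 1) +
        r.length + (l.length + 1) + 2) ?_).mono (by simp; omega)
      simpa [code, cfg, Reg.isAttr, Reg.theSym, attrSym, Sym.isAttr, Sym.toBits, forward] using h

/-- The machine runs over one atom in time linear in its code: the kind letter, one pass from left
to right, and one pass back over the cells. -/
theorem reach_atom {n : ℕ} (a : Atom n) (w d : List Sym) (hw : StartsKind w) (ρ : Fin n → Cell)
    (v : Reg Mode Cell) :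
    ∃ v' : Reg Mode Cell, v'.mode = (P.atomStep (v.mode, ρ) a).1 ∧
      P.Reach (3 * (encodeAtom a).length) (cfg .next v (encodeAtom a ++ w) d (List.ofFn ρ) [])
        (cfg .next v' w ((encodeAtom a).reverse ++ d)
          (List.ofFn (P.atomStep (v.mode, ρ) a).2) []) := by
  obtain ⟨s, h⟩ := reach_fwd (P := P) (List.ofFn (bits a)) w (.kind a.kind :: d) hw (List.ofFn ρ) []
    (by simp) ⟨P.start v.mode a.kind, fun _ => false, some (.kind a.kind), v.cell, v.ans⟩
  simp only [forward_ofFn, Bool.false_or] at h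
  have h₂ := h.trans (reach_bwd _ _ _ _ _)
  refine ⟨⟨(P.atomStep (v.mode, ρ) a).1,
    P.flagsBelow (P.start v.mode a.kind) ρ (bits a) n, s, none, v.ans⟩, rfl,
    (Reach.head rfl (t := (n + 1) + (n + 1)) ?_).mono (by simp [encodeAtom_length]; omega)⟩
  simpa [code, cfg, encodeAtom_eq_encodeBlock, encodeBlock, Reg.isKind, Sym.isAttr, Reg.theSym,
    Sym.toKind, List.map_ofFn, Function.comp_def, atomStep] using h₂

theorem startsKind_flatMap_encodeAtom {n : ℕ} (l : List (Atom n)) (w : List Sym)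
    (hw : StartsKind w) : StartsKind (l.flatMap encodeAtom ++ w) := by
  cases l with
  | nil => simpa using hw
  | cons a l => simp [StartsKind, encodeAtom, Sym.isAttr]

theorem reach_sweep {n : ℕ} (atoms : List (Atom n)) (w d : List Sym) (hw : StartsKind w)
    (ρ : Fin n → Cell) (v : Reg Mode Cell) :
    ∃ v' : Reg Mode Cell, v'.mode = (P.sweep atoms (v.mode, ρ)).1 ∧
      P.Reach (3 * (atoms.flatMap encodeAtom).length)
        (cfg .next v (atoms.flatMap encodeAtom ++ w) d (List.ofFn ρ) [])
        (cfg .next v' w ((atoms.flatMap encodeAtom).reverse ++ d)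
          (List.ofFn (P.sweep atoms (v.mode, ρ)).2) []) := by
  induction atoms generalizing v ρ d with
  | nil => exact ⟨v, rfl, by simpa [sweep] using Reach.refl _ _⟩
  | cons a atoms ih =>
    obtain ⟨v₁, e₁, h₁⟩ := reach_atom (P := P) a (atoms.flatMap encodeAtom ++ w) d
      (startsKind_flatMap_encodeAtom atoms w hw) ρ v
    obtain ⟨v₂, e₂, h₂⟩ := ih ((encodeAtom a).reverse ++ d) (P.atomStep (v.mode, ρ) a).2 v₁
    rw [e₁] at e₂ h₂
    refine ⟨v₂, by simpa [sweep] using e₂, ?_⟩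
    have := (h₁.trans h₂).mono (t := 3 * ((a :: atoms).flatMap encodeAtom).length)
      (by simp only [List.flatMap_cons, List.length_append]; omega)
    simpa [sweep] using this

/-- Each sweep of the program takes linear time, including the way back to the start of the word or
the removal of all letters at the end. -/
theorem reach_run {n : ℕ} (goal : Atom n) (hyps : List (Atom n)) (k : ℕ) (ρ : Fin n → Cell)
    (v : Reg Mode Cell) (b : Bool) (hb : P.run (goal :: hyps) k (v.mode, ρ) = some b) :
    P.Reach (k * (5 * ((goal :: hyps).flatMap encodeAtom).length + 5))
      (cfg .next v ((goal :: hyps).flatMap encodeAtom) [] (List.ofFn ρ) []) (P.final b) := by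
  induction k generalizing ρ v with
  | zero => simp [run] at hb
  | succ k ih =>
    obtain ⟨v₁, e₁, h₁⟩ := reach_sweep (P := P) (goal :: hyps) [] [] (by simp [StartsKind]) ρ v
    simp only [List.append_nil] at h₁
    have hn : n ≤ ((goal :: hyps).flatMap encodeAtom).length := by
      simp only [List.flatMap_cons, List.length_append, encodeAtom_length]; omega
    generalize (goal :: hyps).flatMap encodeAtom = W at *
    rw [run, ← e₁] at hb
    rw [Nat.succ_mul, Nat.add_comm]
    cases hf : P.finish v₁.mode with
    | inl μ =>
      simp only [hf] at hb
      have h₂ := ih (P.sweep (goal :: hyps) (v.mode, ρ)).2 ⟨μ, v₁.fl, none, v₁.cell, v₁.ans⟩ hb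
      have h₃ := (reach_rewind (P := P) [] W.reverse
        (List.ofFn (P.sweep (goal :: hyps) (v.mode, ρ)).2) [] ⟨μ, v₁.fl, none, v₁.cell, v₁.ans⟩)
      simp only [List.reverse_reverse, List.append_nil] at h₃
      refine Reach.trans ((h₁.trans (Reach.head rfl (t := W.length + 1) ?_)).mono (by omega)) h₂
      simpa [code, cfg, Reg.isKind, Reg.isAttr, hf] using h₃
    | inr b' =>
      simp only [hf, Option.some.injEq] at hb
      subst hb
      have h₃ := (reach_clean (P := P) [] W.reverse
        (List.ofFn (P.sweep (goal :: hyps) (v.mode, ρ)).2) [] ⟨v₁.mode, v₁.fl, none, v₁.cell, b'⟩)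
      refine (h₁.trans (Reach.head rfl (t := W.length + n + 1) ?_)).mono (by omega)
      simpa [code, cfg, Reg.isKind, Reg.isAttr, hf] using h₃

/-- The first phase of the machine, which measures the first block and puts up the blank cells. -/
theorem reach_next (k : Kind) (u : List (Bool × Bool)) (w : List Sym) (hw : StartsKind w)
    (v : Reg Mode Cell) :
    ∃ s, P.Reach (2 * u.length + 4) (cfg .first v (encodeBlock (k, u) ++ w) [] [] [])
      (cfg .next { v with sym := s } (encodeBlock (k, u) ++ w) []
        (List.replicate u.length P.blank) []) := by
  obtain ⟨s, h⟩ := reach_build (P := P) u w [.kind k] hw [] { v with sym := some (.kind k) }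
  have h' := h.trans (reach_rewind _ _ _ _ _)
  refine ⟨none, (Reach.head rfl (t := (u.length + 1) + (u.length + 2)) ?_).mono (by omega)⟩
  simpa [code, cfg, encodeBlock, Reg.isKind, Sym.isAttr, Reg.theSym] using h'

/-- A word whose first block of deviating length is `b` is rejected during the first sweep. -/
theorem reach_mismatch {n : ℕ} (goal : Atom n) (hyps : List (Atom n))
    (b : Kind × List (Bool × Bool)) (hb : b.2.length ≠ n) (w : List Sym) (hw : StartsKind w)
    (v : Reg Mode Cell) (ρ : Fin n → Cell) :
    P.Reach (7 * ((goal :: hyps).flatMap encodeAtom ++ (encodeBlock b ++ w)).length + 7)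
      (cfg .next v ((goal :: hyps).flatMap encodeAtom ++ (encodeBlock b ++ w)) [] (List.ofFn ρ) [])
      (P.final false) := by
  obtain ⟨v₁, e₁, h₁⟩ := reach_sweep (P := P) (goal :: hyps) (encodeBlock b ++ w) []
    (by simp [StartsKind, encodeBlock, Sym.isAttr]) ρ v
  have hn : n ≤ ((goal :: hyps).flatMap encodeAtom).length := by
    simp only [List.flatMap_cons, List.length_append, encodeAtom_length]; omega
  generalize (goal :: hyps).flatMap encodeAtom = W at *
  have h₂ := reach_fwd_mismatch (P := P) b.2 w (.kind b.1 :: (W.reverse ++ [])) hw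
    (List.ofFn (P.sweep (goal :: hyps) (v.mode, ρ)).2) [] (by simpa using hb.symm)
    ⟨P.start v₁.mode b.1, fun _ => false, some (.kind b.1), v₁.cell, v₁.ans⟩
  refine (h₁.trans (Reach.head rfl (t := 2 * b.2.length + w.length + W.length + n + 3) ?_)).mono
    (by simp [encodeBlock]; omega)
  refine Reach.mono (s := 2 * b.2.length + w.length + (W.length + 1) + n + 2) ?_ (by omega)
  simpa [code, cfg, encodeBlock, Reg.isKind, Sym.isAttr, Reg.theSym, Sym.toKind] using h₂

theorem reach_first_reject (w : List Sym) (hw : w = [] ∨ ¬ StartsKind w) (v : Reg Mode Cell) :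
    P.Reach (w.length + 2) (cfg .first v w [] [] []) (P.final false) := by
  cases w with
  | nil =>
    have := reach_clean (P := P) [] [] [] [] ⟨v.mode, v.fl, none, v.cell, false⟩
    refine Reach.head rfl ?_
    simpa [code, cfg, Reg.isKind, reject] using this
  | cons s w =>
    have hs : s.isAttr = true := by simpa [StartsKind] using hw
    have := reach_clean (P := P) w [] [] [] ⟨v.mode, v.fl, some s, v.cell, false⟩
    refine (Reach.head rfl (t := w.length + 1) ?_).mono
      (by simp only [List.length_cons]; omega)
    simpa [code, cfg, Reg.isKind, reject, hs] using this

/-- Every word either encodes an instance, or is rejected because the first letter is wrong or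
because a block differs in length from the first one. -/
theorem word_cases (w : List Sym) : (w = [] ∨ ¬ StartsKind w) ∨ (∃ I, w = encodeInstance I) ∨
    ∃ (n : ℕ) (goal : Atom n) (hyps : List (Atom n)) (b : Kind × List (Bool × Bool))
      (w' : List Sym), b.2.length ≠ n ∧ StartsKind w' ∧
      w = (goal :: hyps).flatMap encodeAtom ++ (encodeBlock b ++ w') ∧
      ∀ I, w ≠ encodeInstance I := by
  obtain ⟨u, bs, rfl⟩ := exists_blocks w
  cases u with
  | cons a u => left; right; simp [StartsKind, attrSym, Sym.isAttr]
  | nil =>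
  cases bs with
  | nil => left; left; rfl
  | cons b₀ bs =>
  right
  obtain ⟨goal, hg⟩ := exists_atom_encodeBlock b₀ rfl
  by_cases hall : ∀ b ∈ bs, b.2.length = b₀.2.length
  · left
    have : ∃ hyps : List (Atom b₀.2.length), bs.flatMap encodeBlock = hyps.flatMap encodeAtom := by
      clear hg
      induction bs with
      | nil => exact ⟨[], rfl⟩
      | cons b bs ih =>
        obtain ⟨a, ha⟩ := exists_atom_encodeBlock b (hall b (by simp))
        obtain ⟨l, hl⟩ := ih fun b' hb' => hall b' (by simp [hb'])
        exact ⟨a :: l, by simp [ha, hl]⟩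
    obtain ⟨hyps, hh⟩ := this
    exact ⟨⟨_, hyps, goal⟩, by simp [encodeInstance, hg, hh]⟩
  · right
    have hne : ∀ I, [].map attrSym ++ (b₀ :: bs).flatMap encodeBlock ≠ encodeInstance I := by
      intro I h
      have h1 := congrArg blockLengths h
      rw [List.map_nil, List.nil_append, blockLengths_flatMap, blockLengths_encodeInstance] at h1
      simp only [List.map_cons, Prod.mk.injEq, List.cons.injEq, true_and] at h1
      refine hall fun b hb => ?_
      have : b.2.length ∈ bs.map fun b => b.2.length := List.mem_map_of_mem hb
      rw [h1.2] at this
      obtain ⟨_, _, e⟩ := List.mem_map.1 this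
      rw [← e, h1.1]
    have : ∃ (hyps : List (Atom b₀.2.length)) (b : Kind × List (Bool × Bool)) (w' : List Sym),
        b.2.length ≠ b₀.2.length ∧ StartsKind w' ∧
        bs.flatMap encodeBlock = hyps.flatMap encodeAtom ++ (encodeBlock b ++ w') := by
      clear hg hne
      induction bs with
      | nil => simp at hall
      | cons b bs ih =>
        by_cases hb : b.2.length = b₀.2.length
        · obtain ⟨a, ha⟩ := exists_atom_encodeBlock b hb
          obtain ⟨l, b', w', h1, h2, h3⟩ := ih fun h => hall (by simpa [hb] using h)
          exact ⟨a :: l, b', w', h1, h2, by simp [ha, h3]⟩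
        · exact ⟨[], b, _, hb, startsKind_flatMap bs, by simp⟩
    obtain ⟨hyps, b, w', h1, h2, h3⟩ := this
    exact ⟨_, goal, hyps, b, w', h1, h2, by simp [hg, h3], hne⟩

/-- A language of encodings is decided in polynomial time if some sweep program gives the right
answers after polynomially many sweeps. The single constant `c` serves as summand and exponent of
the bound. -/
theorem inPolynomialTime [Fintype Mode] [Fintype Cell] (P : SweepProgram Mode Cell)
    (L : Set (List Sym)) (hL : ∀ w ∈ L, ∃ I, w = encodeInstance I) (c : ℕ)
    (h : ∀ I : Instance, ∃ (k : ℕ) (b : Bool), k ≤ (I.n + c) ^ c ∧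
      (b = true ↔ encodeInstance I ∈ L) ∧
      P.run (I.goal :: I.hyps) k (P.init, fun _ => P.blank) = some b) :
    InPolynomialTime L := by
  classical
  have key : ∀ w : List Sym, P.Reach (((w.length + c) ^ c + 2) * (7 * w.length + 7))
      (cfg .first ⟨P.init, fun _ => false, none, none, false⟩ w [] [] [])
      (P.final (decide (w ∈ L))) := by
    intro w
    rcases word_cases w with hw | ⟨I, rfl⟩ | ⟨n, goal, hyps, b, w', hb, hw', e, hne⟩
    · have hwL : w ∉ L := by
        intro hmem
        obtain ⟨I, rfl⟩ := hL w hmem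
        simp [encodeInstance, encodeAtom, StartsKind, Sym.isAttr] at hw
      rw [decide_eq_false hwL]
      exact (reach_first_reject w hw _).mono (by rw [Nat.add_mul]; omega)
    · obtain ⟨k, b, hk, hbL, hrun⟩ := h I
      have hb : decide (encodeInstance I ∈ L) = b := by
        rw [Bool.eq_iff_iff, decide_eq_true_iff, hbL]
      have hn : I.n + 1 ≤ (encodeInstance I).length := by
        simp only [encodeInstance, List.length_append, encodeAtom_length]; omega
      have hpow : (I.n + c) ^ c ≤ ((encodeInstance I).length + c) ^ c :=
        Nat.pow_le_pow_left (by omega) c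
      obtain ⟨s, h₁⟩ := reach_next (P := P) I.goal.kind (List.ofFn (bits I.goal))
        (I.hyps.flatMap encodeAtom)
        (by simpa using startsKind_flatMap_encodeAtom I.hyps [] (by simp [StartsKind]))
        ⟨P.init, fun _ => false, none, none, false⟩
      have h₂ := reach_run (P := P) I.goal I.hyps k (fun _ => P.blank)
        ⟨P.init, fun _ => false, s, none, false⟩ b hrun
      rw [← encodeAtom_eq_encodeBlock] at h₁
      rw [List.length_ofFn, ← List.ofFn_const] at h₁
      have h₃ := h₁.trans h₂
      rw [hb]
      refine Reach.mono h₃ ?_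
      change _ + k * (5 * (encodeInstance I).length + 5) ≤ _
      generalize (encodeInstance I).length = m at *
      have : k * (5 * m + 5) ≤ (m + c) ^ c * (7 * m + 7) :=
        Nat.mul_le_mul (by omega) (by omega)
      rw [Nat.add_mul]
      omega
    · have hwL : w ∉ L := by
        intro hmem
        obtain ⟨I, hI⟩ := hL w hmem
        exact hne I hI
      rw [decide_eq_false hwL]
      obtain ⟨s, h₁⟩ := reach_next (P := P) goal.kind (List.ofFn (bits goal))
        (hyps.flatMap encodeAtom ++ (encodeBlock b ++ w'))
        (startsKind_flatMap_encodeAtom hyps _ (by simp [StartsKind, encodeBlock, Sym.isAttr]))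
        ⟨P.init, fun _ => false, none, none, false⟩
      have h₂ := reach_mismatch (P := P) goal hyps b hb w' hw'
        ⟨P.init, fun _ => false, s, none, false⟩ fun _ => P.blank
      rw [← encodeAtom_eq_encodeBlock] at h₁
      rw [List.length_ofFn, ← List.ofFn_const] at h₁
      rw [List.flatMap_cons, List.append_assoc] at h₂ e
      rw [← e] at h₁ h₂
      have hn : n + 1 ≤ w.length := by
        rw [e]; simp only [List.length_append, encodeAtom_length]; omega
      refine (h₁.trans h₂).mono ?_
      rw [Nat.add_mul]
      omega
  -- `7 |w| + 7` bounds the time of a sweep, and two more sweeps pay for the first phase and rejection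
  refine ⟨{
    tm := P.machine
    inputAlphabet := Equiv.refl Sym
    outputAlphabet := Equiv.refl Bool
    time := ((Polynomial.X + Polynomial.C c) ^ c + 2) * (7 * Polynomial.X + 7)
    outputsFun := fun w => ?_ }⟩
  have e₁ : Turing.initList P.machine (w.map (Equiv.refl Sym).invFun) =
      cfg .first ⟨P.init, fun _ => false, none, none, false⟩ w [] [] [] := by
    refine congrArg (Turing.TM2.Cfg.mk _ _) ?_
    funext k
    cases k
    · exact List.map_id _
    all_goals rfl
  have e₂ : Turing.haltList P.machine
      ((Computability.encodeBool (decide (w ∈ L))).map (Equiv.refl Bool).invFun) =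
      P.final (decide (w ∈ L)) := by
    refine congrArg (Turing.TM2.Cfg.mk _ _) ?_
    funext k
    cases k <;> rfl
  have hk : ∃ k ≤ ((w.length + c) ^ c + 2) * (7 * w.length + 7),
      (flip bind P.machine.step)^[k]
        (some (Turing.initList P.machine (w.map (Equiv.refl Sym).invFun))) =
      some (Turing.haltList P.machine
        ((Computability.encodeBool (decide (w ∈ L))).map (Equiv.refl Bool).invFun)) := by
    rw [e₁, e₂]
    exact key w
  exact ⟨⟨hk.choose, hk.choose_spec.2⟩, by simpa using hk.choose_spec.1⟩

end SweepProgram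

/-! ### Groundings and independence -/

section Groundings

variable {Val : Type*} {n : ℕ} {D : ℕ → Set Val}

/-- Independence without the requirement that there are no nulls. -/
def Ind (r : Table D n) (X Y : Finset (Fin n)) : Prop :=
  ∀ t₁ ∈ r, ∀ t₂ ∈ r, ∃ t ∈ r, AgreeOn X t t₁ ∧ AgreeOn Y t t₂

theorem Grounding.ne_none {r r' : Table D n} (h : Grounding r r') {t : Tuple D n} (ht : t ∈ r')
    (i : Fin n) : t i ≠ none := by
  obtain ⟨t₀, -, h₀⟩ := Multiset.exists_mem_of_rel_of_mem (Multiset.rel_flip.2 h) ht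
  exact (h₀ i).1

theorem Grounding.satIA_iff {r r' : Table D n} (h : Grounding r r') (X Y : Finset (Fin n)) :
    SatIA r' X Y ↔ Ind r' X Y :=
  ⟨fun h' => h'.2, fun h' => ⟨fun _ ht i _ => h.ne_none ht i, h'⟩⟩

theorem grounding_map {r : Table D n} {f : Tuple D n → Tuple D n}
    (hf : ∀ t ∈ r, TupleGrounding t (f t)) : Grounding r (r.map f) :=
  Multiset.rel_map_right.2 (Multiset.rel_refl_of_refl_on hf)

theorem grounding_iff_of_total {r : Table D n} (hr : ∀ t ∈ r, ∀ i, t i ≠ none) (r' : Table D n) :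
    Grounding r r' ↔ r' = r := by
  constructor
  · intro h
    have : Multiset.Rel (· = ·) r r' := Multiset.Rel.mono h fun t ht t' _ hg =>
      (funext fun i => ((hg i).2 (hr t ht i))).symm
    exact (Multiset.rel_eq.1 this).symm
  · rintro rfl
    exact Multiset.rel_refl_of_refl_on fun t ht i => ⟨hr t ht i, fun _ => rfl⟩

theorem sat_iff_of_total {r : Table D n} (hr : ∀ t ∈ r, ∀ i, t i ≠ none) (a : Atom n) :
    Sat r a ↔ Ind r a.X a.Y := by
  have hrr := (grounding_iff_of_total hr r).2 rfl
  obtain ⟨k, X, Y⟩ := a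
  cases k <;> simp [Sat, grounding_iff_of_total hr, hrr.satIA_iff]

theorem Ind.symm {r : Table D n} {X Y : Finset (Fin n)} (h : Ind r X Y) : Ind r Y X := by
  intro t₁ h₁ t₂ h₂
  obtain ⟨t, ht, a, b⟩ := h t₂ h₂ t₁ h₁
  exact ⟨t, ht, b, a⟩

theorem Ind.constant {r : Table D n} {X Y : Finset (Fin n)} (h : Ind r X Y) {i : Fin n}
    (hX : i ∈ X) (hY : i ∈ Y) {t₁ t₂ : Tuple D n} (h₁ : t₁ ∈ r) (h₂ : t₂ ∈ r) :
    t₁ i = t₂ i := by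
  obtain ⟨t, -, a, b⟩ := h t₁ h₁ t₂ h₂
  rw [← a i hX, b i hY]

theorem Ind.empty_right (r : Table D n) (X : Finset (Fin n)) : Ind r X ∅ :=
  fun t₁ h₁ _ _ => ⟨t₁, h₁, fun _ _ => rfl, fun i hi => by simp at hi⟩

/-- A block that is independent of the rest of `S` can be split by an independence atom whose sides
cover it (this is the exchange rule). -/
theorem Ind.split {r : Table D n} {b S V W : Finset (Fin n)} (hb : Ind r b (S \ b))
    (h : Ind r V W) (hVW : b ⊆ V ∪ W) : Ind r (b ∩ V) (S \ (b ∩ V)) := by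
  intro t₁ h₁ t₂ h₂
  obtain ⟨t, ht, hV, hW⟩ := h t₁ h₁ t₂ h₂
  obtain ⟨s, hs, hsb, hsS⟩ := hb t ht t₂ h₂
  refine ⟨s, hs, fun i hi => ?_, fun i hi => ?_⟩
  · rw [Finset.mem_inter] at hi
    rw [hsb i hi.1, hV i hi.2]
  · rw [Finset.mem_sdiff, Finset.mem_inter] at hi
    by_cases hib : i ∈ b
    · have := Finset.mem_union.1 (hVW hib)
      rw [hsb i hib, hW i (this.resolve_left fun hV => hi.2 ⟨hib, hV⟩)]
    · exact hsS i (Finset.mem_sdiff.2 ⟨hi.1, hib⟩)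

/-- A block that is independent of the other attributes and disjoint from the right side can be
removed from the left side of an atom. -/
theorem Ind.of_sdiff {r : Table D n} {b x y C : Finset (Fin n)}
    (hC : ∀ i ∈ C, ∀ t₁ ∈ r, ∀ t₂ ∈ r, t₁ i = t₂ i) (hb : Ind r b (((x ∪ y) \ C) \ b))
    (hby : Disjoint b y) (h : Ind r (x \ b) y) : Ind r x y := by
  intro t₁ h₁ t₂ h₂
  obtain ⟨u, hu, hux, huy⟩ := h t₁ h₁ t₂ h₂
  obtain ⟨s, hs, hsb, hsr⟩ := hb t₁ h₁ u hu
  refine ⟨s, hs, fun i hi => ?_, fun i hi => ?_⟩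
  · by_cases hiC : i ∈ C
    · exact hC i hiC s hs t₁ h₁
    by_cases hib : i ∈ b
    · exact hsb i hib
    · rw [hsr i (by simp [hi, hiC, hib]), hux i (by simp [hi, hib])]
  · by_cases hiC : i ∈ C
    · exact hC i hiC s hs t₂ h₂
    have hib : i ∉ b := fun hib => Finset.disjoint_left.1 hby hib hi
    rw [hsr i (by simp [hi, hiC, hib]), huy i hi]

theorem Ind.of_constant {r : Table D n} {x y : Finset (Fin n)}
    (hC : ∀ i ∈ x, ∀ t₁ ∈ r, ∀ t₂ ∈ r, t₁ i = t₂ i) : Ind r x y :=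
  fun t₁ h₁ t₂ h₂ => ⟨t₂, h₂, fun i hi => hC i hi t₂ h₂ t₁ h₁, fun _ _ => rfl⟩

end Groundings

/-! ### Implication of certain independence atoms -/

/-- The attributes that lie on both sides of an atom; those of a satisfied atom are constant. -/
def constants {n : ℕ} (H : List (Atom n)) : Finset (Fin n) :=
  Finset.univ.filter fun i => ∃ a ∈ H, i ∈ a.X ∧ i ∈ a.Y

theorem mem_constants {n : ℕ} {H : List (Atom n)} {i : Fin n} :
    i ∈ constants H ↔ ∃ a ∈ H, i ∈ a.X ∧ i ∈ a.Y := by simp [constants]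

/-- The sides of the certain atom cover the block and both meet it. -/
def Splits {n : ℕ} (b : Finset (Fin n)) (a : Atom n) : Prop :=
  a.kind = .certain ∧ b ⊆ a.X ∪ a.Y ∧ (b ∩ a.X).Nonempty ∧ (b ∩ a.Y).Nonempty

/-- Every relation that satisfies the certain atoms of `H`, read as plain independence atoms, also
satisfies `X ⊥ Y`. -/
def Ent (Val : Type*) {n : ℕ} (H : List (Atom n)) (X Y : Finset (Fin n)) : Prop :=
  ∀ (D : ℕ → Set Val) (r : Table D n), (∀ a ∈ H, a.kind = .certain → Ind r a.X a.Y) → Ind r X Y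

/-- Entailment between plain independence atoms passes to certain atoms: apply it to each
grounding. -/
theorem Ent.implies {Val : Type*} {n : ℕ} {H : List (Atom n)} {goal : Atom n}
    (h : Ent Val H goal.X goal.Y) (hk : goal.kind = .certain) (𝒟 : Set (ℕ → Set Val)) :
    Implies 𝒟 H goal := by
  intro D _ r hr
  simp only [Sat, hk]
  intro r' hr'
  refine (hr'.satIA_iff _ _).2 (h D r' fun a ha hka => ?_)
  have := hr a ha
  simp only [Sat, hka] at this
  exact (this r' hr').2

section CounterModels

variable {Val : Type*} {n : ℕ} {𝒟 : Set (ℕ → Set Val)}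

theorem exists_two_values {D : ℕ → Set Val} (h : ∀ i, (D i).Nontrivial) :
    ∃ z o : (i : ℕ) → D i, ∀ i, z i ≠ o i := by
  have : ∀ i, ∃ x y : D i, x ≠ y := fun i =>
    (Set.nontrivial_coe_sort.2 (h i)).exists_pair_ne
  choose z o hzo using this
  exact ⟨z, o, hzo⟩

/-- An attribute that is common to both sides of the goal, but not of any hypothesis, refutes the
implication: consider two tuples that differ in this attribute only. -/
theorem not_implies_of_common (h𝒟 : ∃ D ∈ 𝒟, ∀ i, (D i).Nontrivial) {H : List (Atom n)}
    {goal : Atom n} {i : Fin n} (hX : i ∈ goal.X) (hY : i ∈ goal.Y)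
    (hH : i ∉ constants H) : ¬ Implies 𝒟 H goal := by
  obtain ⟨D, hD, hD2⟩ := h𝒟
  obtain ⟨z, o, hzo⟩ := exists_two_values hD2
  intro himp
  let t₀ : Tuple D n := fun j => some (z j)
  let t₁ : Tuple D n := fun j => if j = i then some (o j) else some (z j)
  have hr : ∀ t ∈ ({t₀, t₁} : Table D n), ∀ j, t j ≠ none := by
    intro t ht j
    rcases (by simpa using ht : t = t₀ ∨ t = t₁) with rfl | rfl
    · simp [t₀]
    · by_cases hj : j = i <;> simp [t₁, hj]
  have hne : t₀ i ≠ t₁ i := by simpa [t₀, t₁] using hzo i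
  have hagree : ∀ t ∈ ({t₀, t₁} : Table D n), ∀ t' ∈ ({t₀, t₁} : Table D n), ∀ j, j ≠ i →
      t j = t' j := by
    intro t ht t' ht' j hj
    rcases (by simpa using ht : t = t₀ ∨ t = t₁) with rfl | rfl <;>
    rcases (by simpa using ht' : t' = t₀ ∨ t' = t₁) with rfl | rfl <;> simp [t₀, t₁, hj]
  refine hne (Ind.constant ((sat_iff_of_total hr goal).1 (himp D hD _ fun a ha => ?_)) hX hY
    (by simp) (by simp))
  refine (sat_iff_of_total hr a).2 fun s hs s' hs' => ?_
  by_cases hi : i ∈ a.X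
  · have hi' : i ∉ a.Y := fun h => hH (mem_constants.2 ⟨a, ha, hi, h⟩)
    exact ⟨s, hs, fun _ _ => rfl, fun j hj => hagree _ hs _ hs' j fun e => hi' (e ▸ hj)⟩
  · exact ⟨s', hs', fun j hj => hagree _ hs' _ hs j fun e => hi (e ▸ hj), fun _ _ => rfl⟩

/-- A block `b` that meets both sides of the goal and is not split by the hypotheses refutes the
implication. Over finite domains, consider all tuples with a fixed value outside `b`, except for
one value on `b`, and add a tuple that is null on `b`. Every proper part of `b` has all its values,
whatever the grounding is; and the missing value can be supplied by the grounding, which makes the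
possible atoms true, or not, which makes the goal false. -/
theorem not_implies_of_block (h𝒟 : ∃ D ∈ 𝒟, (∀ i, (D i).Nontrivial) ∧ ∀ i, (D i).Finite)
    {H : List (Atom n)} {goal : Atom n} (hk : goal.kind = .certain) {b : Finset (Fin n)}
    (hbC : Disjoint b (constants H)) (hsplit : ∀ a ∈ H, ¬ Splits b a) (hb : b ⊆ goal.X ∪ goal.Y)
    (hbX : (b ∩ goal.X).Nonempty) (hbY : (b ∩ goal.Y).Nonempty)
    (hbXY : ∀ i ∈ b, i ∈ goal.X → i ∉ goal.Y) : ¬ Implies 𝒟 H goal := by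
  classical
  obtain ⟨D, hD, hD2, hDfin⟩ := h𝒟
  obtain ⟨z, o, hzo⟩ := exists_two_values hD2
  intro himp
  have : ∀ i : Fin n, Finite (D i) := fun i => (hDfin i).to_subtype
  have := Fintype.ofFinite (Tuple D n)
  let E : Finset (Tuple D n) := Finset.univ.filter fun t =>
    (∀ i, t i ≠ none) ∧ (∀ i ∉ b, t i = some (z i)) ∧ ∃ i ∈ b, t i ≠ some (z i)
  have hE : ∀ t, t ∈ E ↔ (∀ i, t i ≠ none) ∧ (∀ i ∉ b, t i = some (z i)) ∧
      ∃ i ∈ b, t i ≠ some (z i) := by simp [E]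
  let star : Tuple D n := fun i => if i ∈ b then none else some (z i)
  let r : Table D n := star ::ₘ E.val
  have hground : ∀ r', Grounding r r' ↔ ∃ s : Tuple D n, (∀ i, s i ≠ none) ∧
      (∀ i ∉ b, s i = some (z i)) ∧ r' = s ::ₘ E.val := by
    intro r'
    have htot : ∀ r'', Grounding E.val r'' ↔ r'' = E.val :=
      grounding_iff_of_total fun t ht => ((hE t).1 ht).1
    constructor
    · intro h
      obtain ⟨s, r'', hs, h'', rfl⟩ := Multiset.rel_cons_left.1 h
      refine ⟨s, fun i => (hs i).1, fun i hi => ?_, by rw [(htot r'').1 h'']⟩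
      simpa [star, hi] using (hs i).2
    · rintro ⟨s, hs, hsz, rfl⟩
      refine Multiset.rel_cons_left.2 ⟨s, E.val, fun i => ⟨hs i, fun hi => ?_⟩, (htot _).2 rfl, rfl⟩
      have hib : i ∉ b := fun hib => hi (by simp [star, hib])
      simp [star, hib, hsz i hib]
  have hsat : ∀ a ∈ H, Sat r a := by
    intro a ha
    have hdisj : ∀ i ∈ b, i ∈ a.X → i ∉ a.Y := fun i hi hX hY =>
      Finset.disjoint_left.1 hbC hi (mem_constants.2 ⟨a, ha, hX, hY⟩)
    rcases hka : a.kind with _ | _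
    · simp only [Sat, hka]
      intro r' hr'
      refine (hr'.satIA_iff _ _).2 ?_
      obtain ⟨s, hs, hsz, rfl⟩ := (hground r').1 hr'
      have hz : ∀ t ∈ s ::ₘ E.val, ∀ i ∉ b, t i = some (z i) := by
        intro t ht i hi
        rcases Multiset.mem_cons.1 ht with rfl | ht
        · exact hsz i hi
        · exact ((hE t).1 ht).2.1 i hi
      intro t₁ h₁ t₂ h₂
      by_cases hcov : b ⊆ a.X ∪ a.Y
      · have hns : ¬ ((b ∩ a.X).Nonempty ∧ (b ∩ a.Y).Nonempty) := fun h =>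
          hsplit a ha ⟨hka, hcov, h⟩
        by_cases hX : (b ∩ a.X).Nonempty
        · refine ⟨t₁, h₁, fun _ _ => rfl, fun i hi => ?_⟩
          have hib : i ∉ b := fun hib => hns ⟨hX, i, Finset.mem_inter.2 ⟨hib, hi⟩⟩
          rw [hz _ h₁ i hib, hz _ h₂ i hib]
        · refine ⟨t₂, h₂, fun i hi => ?_, fun _ _ => rfl⟩
          have hib : i ∉ b := fun hib => hX ⟨i, Finset.mem_inter.2 ⟨hib, hi⟩⟩
          rw [hz _ h₁ i hib, hz _ h₂ i hib]
      · -- some attribute of `b` is on neither side: with value `o` there, all values on the sides occur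
        obtain ⟨j, hjb, hj⟩ := Finset.not_subset.1 hcov
        have hjX : j ∉ a.X := fun h => hj (Finset.mem_union_left _ h)
        have hjY : j ∉ a.Y := fun h => hj (Finset.mem_union_right _ h)
        refine ⟨fun i => if i ∈ a.X then t₁ i else if i ∈ a.Y then t₂ i else
          if i ∈ b then some (o i) else some (z i), Multiset.mem_cons_of_mem ((hE _).2 ⟨?_, ?_, ?_⟩),
          ?_, ?_⟩
        · intro i
          have e₁ := hr'.ne_none h₁ i
          have e₂ := hr'.ne_none h₂ i
          split_ifs
          exacts [e₁, e₂, Option.some_ne_none _, Option.some_ne_none _]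
        · intro i hi
          have e₁ := hz _ h₁ i hi
          have e₂ := hz _ h₂ i hi
          split_ifs
          exacts [e₁, e₂, rfl]
        · exact ⟨j, hjb, by simpa [hjX, hjY, hjb] using (hzo j).symm⟩
        · intro i hi
          simp [hi]
        · intro i hi
          by_cases hib : i ∈ b
          · have : i ∉ a.X := fun h => hdisj i hib h hi
            simp [this, hi]
          · have e₁ := hz _ h₁ i hib
            have e₂ := hz _ h₂ i hib
            simp [hi, e₁, e₂]
    · simp only [Sat, hka]
      have hg := (hground _).2 ⟨fun i : Fin n => some (z i), by simp, by simp, rfl⟩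
      refine ⟨_, hg, (hg.satIA_iff _ _).2 ?_⟩
      have hmem : ∀ t, t ∈ (fun i : Fin n => some (z i)) ::ₘ E.val ↔
          (∀ i, t i ≠ none) ∧ ∀ i ∉ b, t i = some (z i) := by
        intro t
        constructor
        · intro ht
          rcases Multiset.mem_cons.1 ht with rfl | ht
          · simp
          · exact ⟨((hE t).1 ht).1, ((hE t).1 ht).2.1⟩
        · rintro ⟨ht, htz⟩
          by_cases hex : ∃ i ∈ b, t i ≠ some (z i)
          · exact Multiset.mem_cons_of_mem ((hE t).2 ⟨ht, htz, hex⟩)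
          · push Not at hex
            refine Multiset.mem_cons.2 (Or.inl (funext fun i => ?_))
            by_cases hi : i ∈ b
            · exact hex i hi
            · exact htz i hi
      intro t₁ h₁ t₂ h₂
      rw [hmem] at h₁ h₂
      refine ⟨fun i => if i ∈ a.X then t₁ i else t₂ i, (hmem _).2 ⟨fun i => ?_, fun i hi => ?_⟩,
        fun i hi => by simp [hi], fun i hi => ?_⟩
      · split_ifs
        exacts [h₁.1 i, h₂.1 i]
      · split_ifs
        exacts [h₁.2 i hi, h₂.2 i hi]
      · by_cases hib : i ∈ b
        · simp [show i ∉ a.X from fun h => hdisj i hib h hi]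
        · simp [h₁.2 i hib, h₂.2 i hib]
  have hgoal := himp D hD r hsat
  simp only [Sat, hk] at hgoal
  obtain ⟨i₀, hi₀⟩ := hbX
  obtain ⟨j₀, hj₀⟩ := hbY
  rw [Finset.mem_inter] at hi₀ hj₀
  -- ground the null tuple to a tuple of `E`; the two tuples that combine to the missing one are in `E`
  have hmemE : ∀ Z : Finset (Fin n), (∃ i ∈ b, i ∉ Z) →
      (fun i => if i ∈ b ∧ i ∉ Z then some (o i) else some (z i) : Tuple D n) ∈ E := by
    rintro Z ⟨i, hib, hiZ⟩
    refine (hE _).2 ⟨fun j => ?_, fun j hj => by simp [hj], i, hib, ?_⟩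
    · split_ifs <;> simp
    · simpa [hib, hiZ] using (hzo i).symm
  have h₁ := hmemE goal.X ⟨j₀, hj₀.1, fun h => hbXY j₀ hj₀.1 h hj₀.2⟩
  have h₂ := hmemE goal.Y ⟨i₀, hi₀.1, hbXY i₀ hi₀.1 hi₀.2⟩
  obtain ⟨t, ht, htX, htY⟩ := (hgoal _ ((hground _).2
    ⟨_, ((hE _).1 h₁).1, ((hE _).1 h₁).2.1, rfl⟩)).2 _ (Multiset.mem_cons_of_mem h₁) _
    (Multiset.mem_cons_of_mem h₂)
  have htE : t ∈ E := by
    rcases Multiset.mem_cons.1 ht with rfl | ht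
    exacts [h₁, ht]
  obtain ⟨j, hjb, hj⟩ := ((hE t).1 htE).2.2
  rcases Finset.mem_union.1 (hb hjb) with hjX | hjY
  · exact hj (by simpa [hjX] using htX j hjX)
  · exact hj (by simpa [hjY] using htY j hjY)

end CounterModels

/-! ### Implication of possible independence atoms -/

section Possible

variable {Val : Type*} {n : ℕ} {𝒟 : Set (ℕ → Set Val)}

/-- Up to constant attributes, the atom `a` has `X` and `Y` on different sides. -/
def Covers (C : Finset (Fin n)) (a : Atom n) (X Y : Finset (Fin n)) : Prop :=
  (X ⊆ a.X ∪ C ∧ Y ⊆ a.Y ∪ C) ∨ (X ⊆ a.Y ∪ C ∧ Y ⊆ a.X ∪ C)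

/-- The criterion for the implication of `X ⊥_p Y`: common attributes are constant, and the atom
follows from constancy alone or from a single hypothesis together with constancy. -/
def PossibleCriterion (H : List (Atom n)) (X Y : Finset (Fin n)) : Prop :=
  (∀ i ∈ X, i ∈ Y → i ∈ constants H) ∧
    (X ⊆ constants H ∨ Y ⊆ constants H ∨ ∃ a ∈ H, Covers (constants H) a X Y)

/-- The criterion is sufficient. Ground the relation by a grounding that satisfies the single
hypothesis, and then overwrite the columns of constant attributes by constants: each such column has
at most one non-null value, since some grounding makes it constant. -/
theorem PossibleCriterion.implies (h_two : ∀ D ∈ 𝒟, ∀ i, (D i).Nontrivial) {H : List (Atom n)}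
    {goal : Atom n} (hH : ∀ a ∈ H, a.kind = .possible) (hk : goal.kind = .possible)
    (h : PossibleCriterion H goal.X goal.Y) : Implies 𝒟 H goal := by
  classical
  intro D hD r hr
  obtain ⟨z, -, -⟩ := exists_two_values (h_two D hD)
  have hsat : ∀ a ∈ H, ∃ r', Grounding r r' ∧ Ind r' a.X a.Y := by
    intro a ha
    have := hr a ha
    simp only [Sat, hH a ha] at this
    obtain ⟨r', h₁, h₂⟩ := this
    exact ⟨r', h₁, h₂.2⟩
  -- the non-null entries in the column of a constant attribute coincide
  have hconst : ∀ i : Fin n, ∃ c : D i, i ∈ constants H → ∀ t ∈ r, t i ≠ none → t i = some c := by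
    intro i
    by_cases hi : i ∈ constants H
    · obtain ⟨a, ha, hX, hY⟩ := mem_constants.1 hi
      obtain ⟨r', hg, hind⟩ := hsat a ha
      by_cases hex : ∃ t ∈ r, t i ≠ none
      · obtain ⟨t, ht, hti⟩ := hex
        obtain ⟨c, hc⟩ := Option.ne_none_iff_exists'.1 hti
        refine ⟨c, fun _ s hs hsi => ?_⟩
        obtain ⟨t', ht', e⟩ := Multiset.exists_mem_of_rel_of_mem hg ht
        obtain ⟨s', hs', e'⟩ := Multiset.exists_mem_of_rel_of_mem hg hs
        rw [← hc, ← (e i).2 hti, ← (e' i).2 hsi]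
        exact hind.constant hX hY hs' ht'
      · exact ⟨z i, fun _ t ht hti => absurd ⟨t, ht, hti⟩ hex⟩
    · exact ⟨z i, fun h => absurd h hi⟩
  choose c hc using hconst
  let fix : Tuple D n → Tuple D n := fun t i => if i ∈ constants H then some (c i) else t i
  have hfix : ∀ r', Grounding r r' → Grounding r (r'.map fix) := by
    intro r' hg
    refine Multiset.rel_map_right.2 (Multiset.Rel.mono hg fun t ht t' _ htt i => ?_)
    by_cases hi : i ∈ constants H
    · simp only [fix, hi, if_true]
      exact ⟨by simp, fun hti => (hc i hi t ht hti).symm⟩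
    · simpa only [fix, hi, if_false] using htt i
  -- it suffices to look at the attributes that are not constant
  suffices hs : ∃ r', Grounding r r' ∧
      Ind r' (goal.X \ constants H) (goal.Y \ constants H) by
    obtain ⟨r', hg, hind⟩ := hs
    simp only [Sat, hk]
    refine ⟨_, hfix r' hg, ((hfix r' hg).satIA_iff _ _).2 ?_⟩
    intro t₁ h₁ t₂ h₂
    obtain ⟨s₁, hs₁, rfl⟩ := Multiset.mem_map.1 h₁
    obtain ⟨s₂, hs₂, rfl⟩ := Multiset.mem_map.1 h₂
    obtain ⟨s, hs, hX, hY⟩ := hind s₁ hs₁ s₂ hs₂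
    refine ⟨_, Multiset.mem_map_of_mem fix hs, fun i hi => ?_, fun i hi => ?_⟩
    · by_cases hiC : i ∈ constants H
      · simp [fix, hiC]
      · simpa [fix, hiC] using hX i (by simp [hi, hiC])
    · by_cases hiC : i ∈ constants H
      · simp [fix, hiC]
      · simpa [fix, hiC] using hY i (by simp [hi, hiC])
  have hg₀ : Grounding r (r.map fun t i => if t i = none then some (z i) else t i) := by
    refine grounding_map fun t _ i => ?_
    by_cases hi : t i = none <;> simp [hi]
  rcases h.2 with hX | hY | ⟨a, ha, hcov⟩
  · rw [Finset.sdiff_eq_empty_iff_subset.2 hX]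
    exact ⟨_, hg₀, (Ind.empty_right _ _).symm⟩
  · rw [Finset.sdiff_eq_empty_iff_subset.2 hY]
    exact ⟨_, hg₀, Ind.empty_right _ _⟩
  · obtain ⟨r', hg, hind⟩ := hsat a ha
    have hsub : ∀ {A B : Finset (Fin n)}, A ⊆ B ∪ constants H → ∀ i ∈ A \ constants H, i ∈ B := by
      intro A B hAB i hi
      rw [Finset.mem_sdiff] at hi
      exact (Finset.mem_union.1 (hAB hi.1)).resolve_right hi.2
    have hweak : ∀ {V W A B : Finset (Fin n)}, Ind r' V W → A ⊆ V ∪ constants H →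
        B ⊆ W ∪ constants H → Ind r' (A \ constants H) (B \ constants H) := by
      intro V W A B hVW hA hB t₁ h₁ t₂ h₂
      obtain ⟨t, ht, a₁, a₂⟩ := hVW t₁ h₁ t₂ h₂
      exact ⟨t, ht, fun i hi => a₁ i (hsub hA i hi), fun i hi => a₂ i (hsub hB i hi)⟩
    rcases hcov with ⟨h₁, h₂⟩ | ⟨h₁, h₂⟩
    · exact ⟨r', hg, hweak hind h₁ h₂⟩
    · exact ⟨r', hg, hweak hind.symm h₁ h₂⟩

/-- If an atom does not have `X` and `Y` on different sides, then its sides can be separated within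
`X ∪ Y` in such a way that one of the two parts meets both `X` and `Y`. -/
theorem exists_mixed_separation {X Y V W : Finset (Fin n)} (hX : X.Nonempty) (hY : Y.Nonempty)
    (hVW : ∀ i ∈ X ∪ Y, i ∈ V → i ∉ W) (h₁ : ¬ (X ⊆ V ∧ Y ⊆ W)) (h₂ : ¬ (X ⊆ W ∧ Y ⊆ V)) :
    ∃ U ⊆ X ∪ Y, (∀ i ∈ X ∪ Y, i ∈ V → i ∈ U) ∧ (∀ i ∈ W, i ∉ U) ∧
      (((∃ i ∈ X, i ∈ U) ∧ ∃ i ∈ Y, i ∈ U) ∨ ((∃ i ∈ X, i ∉ U) ∧ ∃ i ∈ Y, i ∉ U)) := by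
  by_contra hcon
  push Not at hcon
  have hU₁ := hcon ((X ∪ Y) \ W) Finset.sdiff_subset
    (fun i hi hV => Finset.mem_sdiff.2 ⟨hi, hVW i hi hV⟩)
    (fun i hi h => (Finset.mem_sdiff.1 h).2 hi)
  have hU₂ := hcon ((X ∪ Y) ∩ V) Finset.inter_subset_left
    (fun i hi hV => Finset.mem_inter.2 ⟨hi, hV⟩)
    (fun i hi h => hVW i (Finset.mem_inter.1 h).1 (Finset.mem_inter.1 h).2 hi)
  have hW : X ⊆ W ∨ Y ⊆ W := by
    -- the separation that is as large as possible
    by_contra hne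
    push Not at hne
    obtain ⟨i, hi, hiW⟩ := Finset.not_subset.1 hne.1
    obtain ⟨j, hj, hjW⟩ := Finset.not_subset.1 hne.2
    exact hU₁.1 ⟨i, hi, by simp [hi, hiW]⟩ j hj (by simp [hj, hjW])
  have hV : X ⊆ V ∨ Y ⊆ V := by
    -- the separation that is as small as possible
    by_contra hne
    push Not at hne
    obtain ⟨i, hi, hiV⟩ := Finset.not_subset.1 hne.1
    obtain ⟨j, hj, hjV⟩ := Finset.not_subset.1 hne.2
    exact hjV (Finset.mem_inter.1 (hU₂.2 ⟨i, hi, by simp [hiV]⟩ j hj)).2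
  obtain ⟨i, hi⟩ := hX
  obtain ⟨j, hj⟩ := hY
  rcases hW with hW | hW <;> rcases hV with hV | hV
  · exact hVW i (by simp [hi]) (hV hi) (hW hi)
  · exact h₂ ⟨hW, hV⟩
  · exact h₁ ⟨hV, hW⟩
  · exact hVW j (by simp [hj]) (hV hj) (hW hj)

/-- If no hypothesis covers the goal up to constants, then the implication fails. With two values
`z i` and `o i` for each attribute, tuples correspond to subsets of `S = X ∪ Y` (without constants).
Consider all tuples with value `z` on `X` or on `Y`, and add null tuples, one less than the
number of missing tuples. A grounding that satisfies the goal would need all missing tuples. Every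
hypothesis can do with less, as the tuple with value `o` on `S` is not needed. -/
theorem not_implies_of_not_covers (h𝒟 : ∃ D ∈ 𝒟, ∀ i, (D i).Nontrivial) {H : List (Atom n)}
    {goal : Atom n} (hH : ∀ a ∈ H, a.kind = .possible) (hk : goal.kind = .possible)
    (hX : ¬ goal.X ⊆ constants H) (hY : ¬ goal.Y ⊆ constants H)
    (hcov : ∀ a ∈ H, ¬ Covers (constants H) a goal.X goal.Y) : ¬ Implies 𝒟 H goal := by
  classical
  obtain ⟨D, hD, hD2⟩ := h𝒟
  obtain ⟨z, o, hzo⟩ := exists_two_values hD2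
  intro himp
  set X := goal.X \ constants H with hXdef
  set Y := goal.Y \ constants H with hYdef
  have hXne : X.Nonempty := Finset.sdiff_nonempty.2 hX
  have hYne : Y.Nonempty := Finset.sdiff_nonempty.2 hY
  let S := X ∪ Y
  let P := S.powerset.filter fun f => Disjoint f X ∨ Disjoint f Y
  have hP : ∀ f, f ∈ P ↔ f ⊆ S ∧ (Disjoint f X ∨ Disjoint f Y) := by simp [P]
  let τ : Finset (Fin n) → Tuple D n := fun f i => if i ∈ f then some (o i) else some (z i)
  have hτ : ∀ {f g : Finset (Fin n)} {i : Fin n}, (i ∈ f ↔ i ∈ g) → τ f i = τ g i := by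
    intro f g i h
    simp [τ, h]
  let star : Tuple D n := fun i => if i ∈ S then none else some (z i)
  let N := (S.powerset \ P).card - 1
  let r : Table D n := P.val.map τ + Multiset.replicate N star
  have hSP : S ∈ S.powerset \ P := by
    simp only [Finset.mem_sdiff, Finset.mem_powerset, subset_refl, hP, true_and, not_or]
    constructor
    · obtain ⟨i, hi⟩ := hXne
      exact fun h => Finset.disjoint_left.1 h (Finset.mem_union_left _ hi) hi
    · obtain ⟨i, hi⟩ := hYne
      exact fun h => Finset.disjoint_left.1 h (Finset.mem_union_right _ hi) hi
  have hN : N + 1 = (S.powerset \ P).card :=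
    Nat.sub_add_cancel (Finset.card_pos.2 ⟨S, hSP⟩)
  have htot : ∀ r', Grounding (P.val.map τ) r' ↔ r' = P.val.map τ := by
    refine grounding_iff_of_total fun t ht i => ?_
    obtain ⟨f, -, rfl⟩ := Multiset.mem_map.1 ht
    by_cases hi : i ∈ f <;> simp [τ, hi]
  have hsat : ∀ a ∈ H, Sat r a := by
    intro a ha
    have hdisj : ∀ i ∈ X ∪ Y, i ∈ a.X → i ∉ a.Y := by
      intro i hi h₁ h₂
      have hiC : i ∈ constants H := mem_constants.2 ⟨a, ha, h₁, h₂⟩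
      rcases Finset.mem_union.1 hi with hi | hi <;> exact (Finset.mem_sdiff.1 hi).2 hiC
    have hsub : ∀ A B : Finset (Fin n), A \ constants H ⊆ B → A ⊆ B ∪ constants H := by
      intro A B hAB i hi
      by_cases hiC : i ∈ constants H
      · exact Finset.mem_union_right _ hiC
      · exact Finset.mem_union_left _ (hAB (Finset.mem_sdiff.2 ⟨hi, hiC⟩))
    obtain ⟨U, hUS, hVU, hWU, hmix⟩ := exists_mixed_separation hXne hYne hdisj
      (fun h => hcov a ha (Or.inl ⟨hsub _ _ h.1, hsub _ _ h.2⟩))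
      (fun h => hcov a ha (Or.inr ⟨hsub _ _ h.1, hsub _ _ h.2⟩))
    -- the closure of `P` under recombination along `U`, which makes the hypothesis true
    let Q := S.powerset.filter fun f => ∃ g ∈ P, ∃ h ∈ P, f = (g ∩ U) ∪ (h \ U)
    have hQ : ∀ f, f ∈ Q ↔ ∃ g ∈ P, ∃ h ∈ P, f = (g ∩ U) ∪ (h \ U) := by
      intro f
      simp only [Q, Finset.mem_filter, Finset.mem_powerset, and_iff_right_iff_imp]
      rintro ⟨g, hg, h, hh, rfl⟩
      exact Finset.union_subset (Finset.inter_subset_left.trans ((hP g).1 hg).1)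
        (Finset.sdiff_subset.trans ((hP h).1 hh).1)
    have hPQ : P ⊆ Q := fun f hf => (hQ f).2 ⟨f, hf, f, hf, by
      ext i; by_cases hi : i ∈ U <;> simp [hi]⟩
    -- the part of `S` that meets both sides of the goal occurs in no element of `P`
    have hSQ : S ∉ Q := by
      intro hS
      obtain ⟨g, hg, h, hh, e⟩ := (hQ S).1 hS
      have key : ∀ f ∈ P, ¬ ((∃ i ∈ X, i ∈ f) ∧ ∃ i ∈ Y, i ∈ f) := by
        rintro f hf ⟨⟨i, hi, hif⟩, j, hj, hjf⟩
        rcases ((hP f).1 hf).2 with h | h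
        · exact Finset.disjoint_left.1 h hif hi
        · exact Finset.disjoint_left.1 h hjf hj
      have mem : ∀ i ∈ S, (i ∈ U → i ∈ g) ∧ (i ∉ U → i ∈ h) := by
        intro i hi
        rw [e] at hi
        by_cases hiU : i ∈ U <;> simp_all
      rcases hmix with ⟨⟨i, hi, hiU⟩, j, hj, hjU⟩ | ⟨⟨i, hi, hiU⟩, j, hj, hjU⟩
      · exact key g hg ⟨⟨i, hi, (mem i (Finset.mem_union_left _ hi)).1 hiU⟩,
          j, hj, (mem j (Finset.mem_union_right _ hj)).1 hjU⟩
      · exact key h hh ⟨⟨i, hi, (mem i (Finset.mem_union_left _ hi)).2 hiU⟩,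
          j, hj, (mem j (Finset.mem_union_right _ hj)).2 hjU⟩
    have hcard : (Q \ P).card ≤ N := by
      have : (Q \ P).card < (S.powerset \ P).card := by
        refine Finset.card_lt_card ⟨?_, ?_⟩
        · exact Finset.sdiff_subset_sdiff (Finset.filter_subset _ _) subset_rfl
        · exact fun h => hSQ (Finset.mem_sdiff.1 (h hSP)).1
      omega
    have h0P : ∅ ∈ P := (hP ∅).2 ⟨Finset.empty_subset _, Or.inl (Finset.disjoint_empty_left _)⟩
    -- the null tuples supply the tuples of `Q` that are missing, and copies of an old tuple
    let M : Multiset (Finset (Fin n)) := (Q \ P).val + Multiset.replicate (N - (Q \ P).card) ∅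
    have hMQ : ∀ f ∈ M, f ∈ Q := by
      intro f hf
      rcases Multiset.mem_add.1 hf with hf | hf
      · exact (Finset.mem_sdiff.1 hf).1
      · rw [Multiset.eq_of_mem_replicate hf]
        exact hPQ h0P
    have hg : Grounding r (P.val.map τ + M.map τ) := by
      refine Multiset.Rel.add ((htot _).2 rfl) (Multiset.rel_replicate_left.2 ⟨?_, ?_⟩)
      · simp only [M, Multiset.card_map, Multiset.card_add, Multiset.card_replicate,
          Finset.card_val]
        omega
      · intro t ht i
        obtain ⟨f, hf, rfl⟩ := Multiset.mem_map.1 ht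
        have hfS : f ⊆ S := Finset.mem_powerset.1 (Finset.mem_filter.1 (hMQ f hf)).1
        refine ⟨by by_cases hi : i ∈ f <;> simp [τ, hi], fun hi => ?_⟩
        have hiS : i ∉ S := fun hiS => hi (by simp [star, hiS])
        simp [τ, star, hiS, show i ∉ f from fun h => hiS (hfS h)]
    have hmem : ∀ t, t ∈ P.val.map τ + M.map τ ↔ ∃ f ∈ Q, t = τ f := by
      intro t
      simp only [Multiset.mem_add, Multiset.mem_map]
      constructor
      · rintro (⟨f, hf, rfl⟩ | ⟨f, hf, rfl⟩)
        exacts [⟨f, hPQ hf, rfl⟩, ⟨f, hMQ f hf, rfl⟩]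
      · rintro ⟨f, hf, rfl⟩
        by_cases hfP : f ∈ P
        · exact Or.inl ⟨f, hfP, rfl⟩
        · exact Or.inr ⟨f, Multiset.mem_add.2 (Or.inl (Finset.mem_sdiff.2 ⟨hf, hfP⟩)), rfl⟩
    simp only [Sat, hH a ha]
    refine ⟨_, hg, (hg.satIA_iff _ _).2 ?_⟩
    intro t₁ h₁ t₂ h₂
    obtain ⟨f₁, hf₁, rfl⟩ := (hmem _).1 h₁
    obtain ⟨f₂, hf₂, rfl⟩ := (hmem _).1 h₂
    have hS : ∀ g ∈ P, ∀ i ∉ S, i ∉ g := fun g hg i hi h => hi (((hP g).1 hg).1 h)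
    obtain ⟨g₁, hg₁, k₁, hk₁, rfl⟩ := (hQ _).1 hf₁
    obtain ⟨g₂, hg₂, k₂, hk₂, rfl⟩ := (hQ _).1 hf₂
    refine ⟨_, (hmem _).2 ⟨_, (hQ _).2 ⟨g₁, hg₁, k₂, hk₂, rfl⟩, rfl⟩, fun i hi => hτ ?_,
      fun i hi => hτ ?_⟩
    · by_cases hiS : i ∈ S
      · simp [hVU i hiS hi]
      · simp [hS _ hg₁ i hiS, hS _ hk₁ i hiS, hS _ hk₂ i hiS]
    · simp [hWU i hi]
  have hgoal := himp D hD r hsat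
  simp only [Sat, hk] at hgoal
  obtain ⟨r', hg, hsatIA⟩ := hgoal
  obtain ⟨r₀, r₁, hg₀, hg₁, rfl⟩ := Multiset.rel_add_left.1 hg
  rw [(htot r₀).1 hg₀] at *
  have hcard₁ : r₁.card = N := by
    rw [← Multiset.card_eq_card_of_rel hg₁, Multiset.card_replicate]
  -- the tuples of the grounding realize all subsets of `S`
  have hall : S.powerset ⊆
      ((P.val.map τ + r₁).map fun t => S.filter fun i : Fin n => t i = some (o i)).toFinset := by
    intro f hf
    have hfS := Finset.mem_powerset.1 hf
    by_cases hXY : Disjoint X Y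
    · have h₁ : f ∩ X ∈ P := (hP _).2 ⟨Finset.inter_subset_left.trans hfS, Or.inr
        (Finset.disjoint_of_subset_left Finset.inter_subset_right hXY)⟩
      have h₂ : f ∩ Y ∈ P := (hP _).2 ⟨Finset.inter_subset_left.trans hfS, Or.inl
        (Finset.disjoint_of_subset_left Finset.inter_subset_right hXY.symm)⟩
      obtain ⟨t, ht, htX, htY⟩ := hsatIA.2 _
        (Multiset.mem_add.2 (Or.inl (Multiset.mem_map_of_mem τ h₁))) _
        (Multiset.mem_add.2 (Or.inl (Multiset.mem_map_of_mem τ h₂)))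
      rw [Multiset.mem_toFinset, Multiset.mem_map]
      refine ⟨t, ht, ?_⟩
      have hiff : ∀ {i : Fin n} {g : Finset (Fin n)}, τ g i = some (o i) ↔ i ∈ g := by
        intro i g
        by_cases hi : i ∈ g <;> simp [τ, hi, hzo i]
      ext i
      rw [Finset.mem_filter]
      constructor
      · rintro ⟨hiS, hi⟩
        rcases Finset.mem_union.1 hiS with hiX | hiY
        · rw [htX i (Finset.mem_sdiff.1 hiX).1, hiff] at hi
          exact (Finset.mem_inter.1 hi).1
        · rw [htY i (Finset.mem_sdiff.1 hiY).1, hiff] at hi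
          exact (Finset.mem_inter.1 hi).1
      · intro hi
        refine ⟨hfS hi, ?_⟩
        rcases Finset.mem_union.1 (hfS hi) with hiX | hiY
        · rw [htX i (Finset.mem_sdiff.1 hiX).1, hiff]
          exact Finset.mem_inter.2 ⟨hi, hiX⟩
        · rw [htY i (Finset.mem_sdiff.1 hiY).1, hiff]
          exact Finset.mem_inter.2 ⟨hi, hiY⟩
    · obtain ⟨i, hiX, hiY⟩ := Finset.not_disjoint_iff.1 hXY
      exact absurd himp (not_implies_of_common ⟨D, hD, hD2⟩ (Finset.mem_sdiff.1 hiX).1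
        (Finset.mem_sdiff.1 hiY).1 (Finset.mem_sdiff.1 hiX).2)
  have h₁ := (Finset.card_le_card hall).trans (Multiset.toFinset_card_le _)
  rw [Multiset.card_map, Multiset.card_add, Multiset.card_map, Finset.card_val, hcard₁] at h₁
  have h₂ : (S.powerset \ P).card + P.card = S.powerset.card :=
    Finset.card_sdiff_add_card_eq_card (Finset.filter_subset _ _ : P ⊆ S.powerset)
  omega

theorem implies_possible_iff (h_two : ∀ D ∈ 𝒟, ∀ i, (D i).Nontrivial) (h𝒟 : 𝒟.Nonempty)
    {H : List (Atom n)} {goal : Atom n} (hH : ∀ a ∈ H, a.kind = .possible)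
    (hk : goal.kind = .possible) :
    Implies 𝒟 H goal ↔ PossibleCriterion H goal.X goal.Y := by
  obtain ⟨D, hD⟩ := h𝒟
  refine ⟨fun himp => ?_, fun h => h.implies h_two hH hk⟩
  constructor
  · intro i hX hY
    by_contra hi
    exact not_implies_of_common ⟨D, hD, h_two D hD⟩ hX hY hi himp
  · by_contra hcon
    push Not at hcon
    exact not_implies_of_not_covers ⟨D, hD, h_two D hD⟩ hH hk hcon.1 hcon.2.1 hcon.2.2 himp

end Possible

open SweepProgram

/-! ### The sweep program for certain goals -/

/-- The phases of the program for certain goals: reading the input into the cells, starting with a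
new block, and splitting the current block. -/
inductive Phase
  | load
  | select
  | refine
  deriving DecidableEq

instance : Fintype Phase where
  elems := {.load, .select, .refine}
  complete p := by cases p <;> decide

/-- The mode of the program for certain goals. Here `fresh` tells that no atom has been read in this
sweep, `goal` that the current atom is the goal, `bad` that the answer is negative, `done` that the
answer is positive, and `changed` that the block has been split in this sweep. -/
structure CertainMode where
  phase : Phase
  fresh : Bool
  goal : Bool
  kind : Kind
  bad : Bool
  done : Bool
  changed : Bool

/-- A cell of the program for certain goals: membership of the attribute in the left side of the
goal (as far as it is still to be treated), in its right side, among the constants, in the current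
block, and in the two sides of the current atom. -/
structure CertainCell where
  x : Bool
  y : Bool
  c : Bool
  b : Bool
  v : Bool
  w : Bool

instance : Fintype Kind where
  elems := {.certain, .possible}
  complete k := by cases k <;> decide

noncomputable instance : Fintype CertainMode :=
  Fintype.ofInjective
    (fun μ => (μ.phase, μ.fresh, μ.goal, μ.kind, μ.bad, μ.done, μ.changed) :
      CertainMode → Phase × Bool × Bool × Kind × Bool × Bool × Bool)
    (by rintro ⟨⟩ ⟨⟩ h; simpa using h)

noncomputable instance : Fintype CertainCell :=
  Fintype.ofInjective
    (fun c => (c.x, c.y, c.c, c.b, c.v, c.w) :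
      CertainCell → Bool × Bool × Bool × Bool × Bool × Bool)
    (by rintro ⟨⟩ ⟨⟩ h; simpa using h)

/-- The current atom splits the current block. -/
def CertainMode.splits (μ : CertainMode) (fl : Flags) : Bool :=
  decide (μ.kind = .certain) && !fl 0 && fl 1 && fl 2

/-- The program for certain goals. With `mixed = false` it accepts certain atoms only, and with
`mixed = true` disjoint atoms only. It takes a block that contains all attributes of the goal that
are not constant, splits it by the hypotheses as long as possible, keeping a part that meets the
left side, and removes the final block from the left side, unless it meets the right side. -/
def certainProgram (mixed : Bool) : SweepProgram CertainMode CertainCell where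
  init := ⟨.load, true, false, .certain, false, false, false⟩
  blank := ⟨false, false, false, false, false, false⟩
  start μ k := { μ with fresh := false, goal := μ.fresh, kind := k }
  test μ c v w :=
    match μ.phase, μ.goal with
    | .load, _ => ![v && w, false, false, false]
    | .select, true => ![c.b && c.y, c.x && !c.b && !c.c, false, false]
    | .refine, true => ![false, false, false, false]
    | _, false => ![c.b && !(v || w), c.b && v, c.b && w, c.b && v && c.x]
  write μ _ c v w :=
    match μ.phase, μ.goal with
    | .load, true => { c with x := v, y := w }
    | .load, false => { c with c := c.c || (v && w) }
    | .select, true => { c with x := c.x && !c.b, b := ((c.x && !c.b) || c.y) && !c.c }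
    | .refine, true => c
    | _, false => { c with v := v, w := w }
  settle μ fl :=
    match μ.phase, μ.goal with
    | .load, true => { μ with bad := (mixed && fl 0) || decide (μ.kind ≠ .certain) }
    | .load, false =>
      { μ with bad := μ.bad || (mixed && fl 0) || (!mixed && decide (μ.kind ≠ .certain)) }
    | .select, true => { μ with bad := fl 0, done := !fl 1, changed := false }
    | .refine, true => { μ with changed := false }
    | _, false => { μ with changed := μ.changed || μ.splits fl }
  update μ fl c :=
    match μ.phase, μ.goal with
    | .load, _ => c
    | _, true => c
    | _, false => if μ.splits fl then { c with b := c.b && if fl 3 then c.v else c.w } else c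
  finish μ :=
    match μ.phase with
    | .load => if μ.bad then .inr false else .inl { μ with phase := .select, fresh := true }
    | .select =>
      if μ.bad then .inr false
      else if μ.done then .inr true
      else .inl { μ with phase := if μ.changed then .refine else .select, fresh := true }
    | .refine =>
      .inl { μ with phase := if μ.changed then .refine else .select, fresh := true }

section CertainProgram

variable {n : ℕ}

/-- The cells hold the given sets. -/
def CertainRep (ρ : Fin n → CertainCell) (x y C b : Finset (Fin n)) : Prop :=
  ∀ i, (ρ i).x = decide (i ∈ x) ∧ (ρ i).y = decide (i ∈ y) ∧ (ρ i).c = decide (i ∈ C) ∧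
    (ρ i).b = decide (i ∈ b)

instance (b : Finset (Fin n)) (a : Atom n) : Decidable (Splits b a) := by
  unfold Splits; infer_instance

/-- The part of the block that is kept when the atom splits it. -/
def refineBlock (x b : Finset (Fin n)) (a : Atom n) : Finset (Fin n) :=
  if Splits b a then if (b ∩ a.X ∩ x).Nonempty then b ∩ a.X else b ∩ a.Y else b

variable {mixed : Bool} {x y C b : Finset (Fin n)}

theorem certain_load_goal (ρ : Fin n → CertainCell) (hρ : CertainRep ρ ∅ ∅ ∅ ∅) (a : Atom n)
    (μ : CertainMode) (hμ : μ.phase = .load) (hf : μ.fresh = true) :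
    CertainRep ((certainProgram mixed).atomStep (μ, ρ) a).2 a.X a.Y ∅ ∅ ∧
    ((certainProgram mixed).atomStep (μ, ρ) a).1.phase = .load ∧
    ((certainProgram mixed).atomStep (μ, ρ) a).1.fresh = false ∧
    (((certainProgram mixed).atomStep (μ, ρ) a).1.bad = false ↔
      a.kind = .certain ∧ (mixed = true → Disjoint a.X a.Y)) := by
  obtain ⟨ph, fr, go, k, ba, dn, ch⟩ := μ
  subst hμ hf
  refine ⟨fun i => ?_, rfl, rfl, ?_⟩
  · have := hρ i
    simp_all [atomStep, certainProgram, bits]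
  · simp [atomStep, certainProgram, bits, flagsBelow_all, Finset.disjoint_left]
    tauto

theorem certain_load_hyps (H : List (Atom n)) (ρ : Fin n → CertainCell)
    (hρ : CertainRep ρ x y C ∅) (μ : CertainMode) (hμ : μ.phase = .load) (hf : μ.fresh = false) :
    CertainRep ((certainProgram mixed).sweep H (μ, ρ)).2 x y (C ∪ constants H) ∅ ∧
    ((certainProgram mixed).sweep H (μ, ρ)).1.phase = .load ∧
    (((certainProgram mixed).sweep H (μ, ρ)).1.bad = false ↔ μ.bad = false ∧
      ∀ a ∈ H, if mixed then Disjoint a.X a.Y else a.kind = .certain) := by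
  induction H generalizing ρ μ C with
  | nil =>
    refine ⟨?_, hμ, by simp [sweep]⟩
    have : constants ([] : List (Atom n)) = ∅ := by ext; simp [mem_constants]
    rw [this, Finset.union_empty]
    exact hρ
  | cons a H ih =>
    obtain ⟨ph, fr, go, k, ba, dn, ch⟩ := μ
    subst hμ hf
    have h₁ : CertainRep ((certainProgram mixed).atomStep (⟨.load, false, go, k, ba, dn, ch⟩, ρ) a).2
        x y (C ∪ (a.X ∩ a.Y)) ∅ := by
      intro i
      have := hρ i
      simp_all [atomStep, certainProgram, bits]
    obtain ⟨i₁, i₂, i₃⟩ := ih _ h₁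
      ((certainProgram mixed).atomStep (⟨.load, false, go, k, ba, dn, ch⟩, ρ) a).1 rfl rfl
    have e : C ∪ (a.X ∩ a.Y) ∪ constants H = C ∪ constants (a :: H) := by
      ext i
      simp [mem_constants]
    rw [e] at i₁
    refine ⟨i₁, i₂, i₃.trans ?_⟩
    have : ((certainProgram mixed).atomStep (⟨.load, false, go, k, ba, dn, ch⟩, ρ) a).1.bad = false ↔
        ba = false ∧ if mixed then Disjoint a.X a.Y else a.kind = .certain := by
      cases mixed <;>
      simp [atomStep, certainProgram, bits, flagsBelow_all, Finset.disjoint_left]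
    rw [this]
    simp [and_assoc]

/-- The flags decide whether the atom splits the block, and whether its left part meets the left side
of the goal. -/
theorem certain_flags (ρ : Fin n → CertainCell) (hρ : CertainRep ρ x y C b) (a : Atom n)
    (μ : CertainMode) (hμ : μ.phase ≠ .load) (hg : μ.goal = false) (hk : μ.kind = a.kind) :
    μ.splits ((certainProgram mixed).flagsBelow μ ρ (bits a) n) = decide (Splits b a) ∧
    (certainProgram mixed).flagsBelow μ ρ (bits a) n 3 = decide ((b ∩ a.X ∩ x).Nonempty) := by
  obtain ⟨ph, fr, go, k, ba, dn, ch⟩ := μ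
  simp only at hμ hg hk
  subst hg hk
  have hx : ∀ i, (ρ i).x = decide (i ∈ x) := fun i => (hρ i).1
  have hb : ∀ i, (ρ i).b = decide (i ∈ b) := fun i => (hρ i).2.2.2
  have h₀ : (certainProgram mixed).flagsBelow ⟨ph, fr, false, a.kind, ba, dn, ch⟩ ρ (bits a) n 0 =
      decide (∃ i, i ∈ b ∧ i ∉ a.X ∧ i ∉ a.Y) := by
    cases ph <;> simp_all [flagsBelow_all, certainProgram, bits]
  have h₁ : (certainProgram mixed).flagsBelow ⟨ph, fr, false, a.kind, ba, dn, ch⟩ ρ (bits a) n 1 =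
      decide (∃ i, i ∈ b ∧ i ∈ a.X) := by
    cases ph <;> simp_all [flagsBelow_all, certainProgram, bits]
  have h₂ : (certainProgram mixed).flagsBelow ⟨ph, fr, false, a.kind, ba, dn, ch⟩ ρ (bits a) n 2 =
      decide (∃ i, i ∈ b ∧ i ∈ a.Y) := by
    cases ph <;> simp_all [flagsBelow_all, certainProgram, bits]
  constructor
  · simp only [CertainMode.splits, h₀, h₁, h₂, Splits, Finset.subset_iff, Finset.Nonempty,
      Finset.mem_union, Finset.mem_inter]
    rw [Bool.eq_iff_iff]
    simp only [Bool.and_eq_true, decide_eq_true_eq, Bool.not_eq_true', decide_eq_false_iff_not]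
    push Not
    simp only [and_assoc, or_iff_not_imp_left]
  · cases ph <;> simp_all [flagsBelow_all, certainProgram, bits, Finset.Nonempty, and_assoc]

theorem certain_hyp (ρ : Fin n → CertainCell) (hρ : CertainRep ρ x y C b) (a : Atom n)
    (μ : CertainMode) (hμ : μ.phase ≠ .load) (hf : μ.fresh = false) :
    CertainRep ((certainProgram mixed).atomStep (μ, ρ) a).2 x y C (refineBlock x b a) ∧
    ((certainProgram mixed).atomStep (μ, ρ) a).1 =
      { μ with goal := false, kind := a.kind, changed := μ.changed || decide (Splits b a) } := by
  obtain ⟨ph, fr, go, k, ba, dn, ch⟩ := μ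
  subst hf
  obtain ⟨h₁, h₂⟩ := certain_flags (mixed := mixed) ρ hρ a ⟨ph, false, false, a.kind, ba, dn, ch⟩ hμ
    rfl rfl
  have e : (certainProgram mixed).start ⟨ph, false, go, k, ba, dn, ch⟩ a.kind =
      ⟨ph, false, false, a.kind, ba, dn, ch⟩ := rfl
  simp only [atomStep, e]
  generalize (certainProgram mixed).flagsBelow ⟨ph, false, false, a.kind, ba, dn, ch⟩ ρ (bits a) n =
    fl at h₁ h₂
  have h₃ : ∀ f ba dn ch, CertainMode.splits ⟨ph, f, false, a.kind, ba, dn, ch⟩ fl =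
      decide (Splits b a) := fun _ _ _ _ => h₁
  constructor
  · intro i
    obtain ⟨hx, hy, hc, hb⟩ := hρ i
    cases ph
    · exact absurd rfl hμ
    all_goals
      by_cases hs : Splits b a
      · by_cases h : (b ∩ a.X ∩ x).Nonempty <;>
          simp [-Finset.inter_assoc, certainProgram, h₃, hs, h₂, h, refineBlock, hx, hy, hc, hb,
            bits]
      · simp [certainProgram, h₃, hs, refineBlock, hx, hy, hc, hb]
  · cases ph
    · exact absurd rfl hμ
    all_goals simp [certainProgram, h₃]

theorem certain_select_goal (ρ : Fin n → CertainCell) (hρ : CertainRep ρ x y C b) (a : Atom n)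
    (μ : CertainMode) (hμ : μ.phase = .select) (hf : μ.fresh = true) :
    CertainRep ((certainProgram mixed).atomStep (μ, ρ) a).2 (x \ b) y C ((x \ b ∪ y) \ C) ∧
    ((certainProgram mixed).atomStep (μ, ρ) a).1 =
      ⟨.select, false, true, a.kind, decide (∃ i ∈ b, i ∈ y), decide (x \ b ⊆ C), false⟩ := by
  obtain ⟨ph, fr, go, k, ba, dn, ch⟩ := μ
  subst hμ hf
  constructor
  · intro i
    obtain ⟨hx, hy, hc, hb⟩ := hρ i
    simp [atomStep, certainProgram, hx, hy, hc, hb]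
  · have hx : ∀ i, (ρ i).x = decide (i ∈ x) := fun i => (hρ i).1
    have hy : ∀ i, (ρ i).y = decide (i ∈ y) := fun i => (hρ i).2.1
    have hc : ∀ i, (ρ i).c = decide (i ∈ C) := fun i => (hρ i).2.2.1
    have hb : ∀ i, (ρ i).b = decide (i ∈ b) := fun i => (hρ i).2.2.2
    simp [atomStep, certainProgram, flagsBelow_all, hx, hy, hc, hb, Finset.subset_iff]
    rw [← decide_not]
    push Not
    simp only [and_assoc]

theorem certain_refine_goal (ρ : Fin n → CertainCell) (hρ : CertainRep ρ x y C b) (a : Atom n)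
    (μ : CertainMode) (hμ : μ.phase = .refine) (hf : μ.fresh = true) :
    CertainRep ((certainProgram mixed).atomStep (μ, ρ) a).2 x y C b ∧
    ((certainProgram mixed).atomStep (μ, ρ) a).1 =
      ⟨.refine, false, true, a.kind, μ.bad, μ.done, false⟩ := by
  obtain ⟨ph, fr, go, k, ba, dn, ch⟩ := μ
  subst hμ hf
  exact ⟨hρ, rfl⟩

/-- Some hypothesis splits the block, or the part that is kept, when it is its turn. -/
def splitsSome (x : Finset (Fin n)) : Finset (Fin n) → List (Atom n) → Bool
  | _, [] => false
  | b, a :: H => decide (Splits b a) || splitsSome x (refineBlock x b a) H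

theorem certain_hyps (H : List (Atom n)) (ρ : Fin n → CertainCell) (hρ : CertainRep ρ x y C b)
    (μ : CertainMode) (hμ : μ.phase ≠ .load) (hf : μ.fresh = false) :
    CertainRep ((certainProgram mixed).sweep H (μ, ρ)).2 x y C (H.foldl (refineBlock x) b) ∧
    ((certainProgram mixed).sweep H (μ, ρ)).1.phase = μ.phase ∧
    ((certainProgram mixed).sweep H (μ, ρ)).1.bad = μ.bad ∧
    ((certainProgram mixed).sweep H (μ, ρ)).1.done = μ.done ∧
    ((certainProgram mixed).sweep H (μ, ρ)).1.changed = (μ.changed || splitsSome x b H) := by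
  induction H generalizing ρ μ b with
  | nil => exact ⟨hρ, rfl, rfl, rfl, by simp [splitsSome, sweep]⟩
  | cons a H ih =>
    obtain ⟨h₁, h₂⟩ := certain_hyp (mixed := mixed) ρ hρ a μ hμ hf
    have h₃ := ih _ h₁ ((certainProgram mixed).atomStep (μ, ρ) a).1 (by rw [h₂]; exact hμ)
      (by rw [h₂]; exact hf)
    have e : (certainProgram mixed).sweep (a :: H) (μ, ρ) =
      (certainProgram mixed).sweep H (((certainProgram mixed).atomStep (μ, ρ) a).1,
        ((certainProgram mixed).atomStep (μ, ρ) a).2) := rfl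
    rw [e]
    refine ⟨h₃.1, ?_, ?_, ?_, ?_⟩
    · rw [h₃.2.1, h₂]
    · rw [h₃.2.2.1, h₂]
    · rw [h₃.2.2.2.1, h₂]
    · rw [h₃.2.2.2.2, h₂]
      simp [splitsSome, Bool.or_assoc]

/-- The invariant of the current block: it consists of nonconstant attributes of the goal, meets the
left side, and is independent of the other nonconstant attributes of the goal. -/
structure BlockInv (Val : Type*) (H : List (Atom n)) (x y b : Finset (Fin n)) : Prop where
  disj : Disjoint b (constants H)
  sub : b ⊆ x ∪ y
  meets : (b ∩ x).Nonempty
  ent : Ent Val H b (((x ∪ y) \ constants H) \ b)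

/-- By the exchange rule, splitting preserves the invariant. The kept part meets the left side of
the goal, and it is smaller because the two sides of the atom are disjoint on `b`. -/
theorem BlockInv.refineBlock {Val : Type*} {H : List (Atom n)} (h : BlockInv Val H x y b)
    {a : Atom n} (ha : a ∈ H) (hs : Splits b a) :
    BlockInv Val H x y (refineBlock x b a) ∧ (refineBlock x b a).card < b.card := by
  obtain ⟨hk, hcov, ⟨i, hi⟩, ⟨j, hj⟩⟩ := id hs
  rw [Finset.mem_inter] at hi hj
  have hdisj : ∀ i ∈ b, i ∈ a.X → i ∉ a.Y := fun i hi hX hY =>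
    Finset.disjoint_left.1 h.disj hi (mem_constants.2 ⟨a, ha, hX, hY⟩)
  rw [IncompleteIndependence.refineBlock, if_pos hs]
  split_ifs with hx
  · refine ⟨⟨h.disj.mono_left Finset.inter_subset_left, Finset.inter_subset_left.trans h.sub, hx,
      fun D r hr => (h.ent D r hr).split (hr a ha hk) hcov⟩, Finset.card_lt_card ⟨
      Finset.inter_subset_left, fun hsub => ?_⟩⟩
    exact hdisj j hj.1 (Finset.mem_inter.1 (hsub hj.1)).2 hj.2
  · refine ⟨⟨h.disj.mono_left Finset.inter_subset_left, Finset.inter_subset_left.trans h.sub, ?_,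
      fun D r hr => (h.ent D r hr).split (hr a ha hk).symm (by rwa [Finset.union_comm])⟩,
      Finset.card_lt_card ⟨Finset.inter_subset_left, fun hsub => ?_⟩⟩
    · obtain ⟨l, hl⟩ := h.meets
      rw [Finset.mem_inter] at hl
      rcases Finset.mem_union.1 (hcov hl.1) with hX | hY
      · exact absurd ⟨l, by simp [hl.1, hl.2, hX]⟩ hx
      · exact ⟨l, by simp [hl.1, hl.2, hY]⟩
    · exact hdisj i hi.1 hi.2 (Finset.mem_inter.1 (hsub hi.1)).2

theorem BlockInv.foldl {Val : Type*} {H : List (Atom n)} (h : BlockInv Val H x y b)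
    (H' : List (Atom n)) (hH : H' ⊆ H) :
    BlockInv Val H x y (H'.foldl (IncompleteIndependence.refineBlock x) b) ∧
    (H'.foldl (IncompleteIndependence.refineBlock x) b).card ≤ b.card ∧
    (splitsSome x b H' = true →
      (H'.foldl (IncompleteIndependence.refineBlock x) b).card < b.card) ∧
    (splitsSome x b H' = false → H'.foldl (IncompleteIndependence.refineBlock x) b = b ∧
      ∀ a ∈ H', ¬ Splits b a) := by
  induction H' generalizing b with
  | nil => exact ⟨h, le_rfl, by simp [splitsSome], by simp⟩
  | cons a H' ih =>
    have haH := hH List.mem_cons_self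
    have hH' : H' ⊆ H := fun x hx => hH (List.mem_cons_of_mem _ hx)
    by_cases hs : Splits b a
    · obtain ⟨h₁, h₂⟩ := h.refineBlock haH hs
      obtain ⟨i₁, i₂, i₃, i₄⟩ := ih h₁ hH'
      exact ⟨i₁, by simp only [List.foldl_cons]; omega, fun _ => by
        simp only [List.foldl_cons]; omega, by simp [splitsSome, hs]⟩
    · have e : IncompleteIndependence.refineBlock x b a = b := by
        rw [IncompleteIndependence.refineBlock, if_neg hs]
      obtain ⟨i₁, i₂, i₃, i₄⟩ := ih h hH'
      simp only [List.foldl_cons, e, splitsSome, hs, decide_false, Bool.false_or]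
      exact ⟨i₁, i₂, i₃, fun hf => ⟨(i₄ hf).1, by simpa [hs] using (i₄ hf).2⟩⟩

/-- A final block that meets the right side of the goal refutes the implication. -/
theorem BlockInv.not_implies {Val : Type*} {𝒟 : Set (ℕ → Set Val)}
    (h𝒟 : ∃ D ∈ 𝒟, (∀ i, (D i).Nontrivial) ∧ ∀ i, (D i).Finite) {H : List (Atom n)}
    {goal : Atom n} (hk : goal.kind = .certain) (hx : x ⊆ goal.X)
    (h : BlockInv Val H x goal.Y b) (hs : ∀ a ∈ H, ¬ Splits b a) (hby : ∃ i ∈ b, i ∈ goal.Y) :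
    ¬ Implies 𝒟 H goal := by
  by_cases hcom : ∃ i ∈ b, i ∈ goal.X ∧ i ∈ goal.Y
  · obtain ⟨i, hib, hX, hY⟩ := hcom
    obtain ⟨D, hD, hD2, -⟩ := h𝒟
    exact not_implies_of_common ⟨D, hD, hD2⟩ hX hY (Finset.disjoint_left.1 h.disj hib)
  · push Not at hcom
    obtain ⟨i, hib, hi⟩ := hby
    exact not_implies_of_block h𝒟 hk h.disj hs (h.sub.trans (Finset.union_subset_union_left hx))
      (h.meets.mono (Finset.inter_subset_inter_left hx)) ⟨i, by simp [hib, hi]⟩ hcom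

/-- The invariant at the start of a sweep: the goal can be reduced to the remaining left side `x`,
and unless the program is about to begin with the first block, the current block is admissible and,
before the selection of a new block, final. -/
structure LoopInv (Val : Type*) (H : List (Atom n)) (goal : Atom n) (ph : Phase)
    (x b : Finset (Fin n)) : Prop where
  sub : x ⊆ goal.X
  ent : Ent Val H x goal.Y → Ent Val H goal.X goal.Y
  phase : ph ≠ .load
  select : ph = .select → b = ∅ ∨ BlockInv Val H x goal.Y b ∧ ∀ a ∈ H, ¬ Splits b a
  refine : ph = .refine → BlockInv Val H x goal.Y b

/-- A bound for the number of sweeps that remain. Each final block removes a nonconstant attribute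
from the left side, and each sweep that is not the last one for its block makes the block
smaller. -/
def sweepBound (C : Finset (Fin n)) (ph : Phase) (x b : Finset (Fin n)) : ℕ :=
  if ph = .refine then (x \ C).card * (n + 3) + b.card + 1
  else ((x \ b) \ C).card * (n + 3) + (n + 2)

/-- A final block removes a nonconstant attribute from the left side. -/
theorem BlockInv.card_sdiff {Val : Type*} {H : List (Atom n)} (h : BlockInv Val H x y b) :
    ((x \ b) \ constants H).card + 1 ≤ (x \ constants H).card := by
  refine Finset.card_lt_card ⟨Finset.sdiff_subset_sdiff Finset.sdiff_subset subset_rfl, fun hs => ?_⟩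
  obtain ⟨i, hi⟩ := h.meets
  rw [Finset.mem_inter] at hi
  have := hs (Finset.mem_sdiff.2 ⟨hi.2, Finset.disjoint_left.1 h.disj hi.1⟩)
  simp [hi.1] at this

/-- From a state that satisfies the invariant, the program decides the implication. Constants come
from certain hypotheses here: either all hypotheses are certain, or all are disjoint and there are
no constants. -/
theorem certain_run {Val : Type*} {𝒟 : Set (ℕ → Set Val)}
    (h𝒟 : ∃ D ∈ 𝒟, (∀ i, (D i).Nontrivial) ∧ ∀ i, (D i).Finite) {H : List (Atom n)}
    {goal : Atom n} (hk : goal.kind = .certain)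
    (hC : ∀ a ∈ H, ∀ i, i ∈ a.X → i ∈ a.Y → a.kind = .certain) (m : ℕ)
    (x b : Finset (Fin n)) (μ : CertainMode) (hf : μ.fresh = true) (ρ : Fin n → CertainCell)
    (hρ : CertainRep ρ x goal.Y (constants H) b) (hinv : LoopInv Val H goal μ.phase x b)
    (hm : sweepBound (constants H) μ.phase x b ≤ m) :
    ∃ (k : ℕ) (ans : Bool), k ≤ m + 1 ∧ (ans = true ↔ Implies 𝒟 H goal) ∧
      (certainProgram mixed).run (goal :: H) k (μ, ρ) = some ans := by
  have hconst : ∀ (D : ℕ → Set Val) (r : Table D n),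
      (∀ a ∈ H, a.kind = .certain → Ind r a.X a.Y) →
      ∀ i ∈ constants H, ∀ t₁ ∈ r, ∀ t₂ ∈ r, t₁ i = t₂ i := by
    intro D r hr i hi t₁ h₁ t₂ h₂
    obtain ⟨a, ha, hX, hY⟩ := mem_constants.1 hi
    exact (hr a ha (hC a ha i hX hY)).constant hX hY h₁ h₂
  induction m generalizing x b μ ρ with
  | zero =>
    simp only [sweepBound] at hm
    split_ifs at hm <;> omega
  | succ m ih =>
    cases hph : μ.phase with
    | load => exact absurd hph hinv.phase
    | refine =>
      obtain ⟨hρ₁, e₁⟩ := certain_refine_goal (mixed := mixed) ρ hρ goal μ hph hf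
      obtain ⟨hρ₂, p₂, -, -, c₂⟩ := certain_hyps (mixed := mixed) H _ hρ₁
        ((certainProgram mixed).atomStep (μ, ρ) goal).1 (by rw [e₁]; simp) (by rw [e₁])
      have hB := hinv.refine hph
      obtain ⟨j₁, j₂, j₃, j₄⟩ := hB.foldl H (List.Subset.refl H)
      have es : (certainProgram mixed).sweep (goal :: H) (μ, ρ) =
        (certainProgram mixed).sweep H (((certainProgram mixed).atomStep (μ, ρ) goal).1,
          ((certainProgram mixed).atomStep (μ, ρ) goal).2) := rfl
      rw [← es] at hρ₂ p₂ c₂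
      rw [e₁] at p₂ c₂
      simp only [Bool.false_or] at p₂ c₂
      rw [hph] at hm
      simp only [sweepBound, if_true] at hm
      have hfin : (certainProgram mixed).finish ((certainProgram mixed).sweep (goal :: H) (μ, ρ)).1 =
          .inl { ((certainProgram mixed).sweep (goal :: H) (μ, ρ)).1 with
            phase := if splitsSome x b H then .refine else .select, fresh := true } := by
        simp only [certainProgram] at p₂ c₂ ⊢
        simp only [p₂, c₂]
      obtain ⟨k, ans, hk₁, hk₂, hk₃⟩ := ih x (H.foldl (refineBlock x) b)
        { ((certainProgram mixed).sweep (goal :: H) (μ, ρ)).1 with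
            phase := if splitsSome x b H then .refine else .select, fresh := true } rfl _ hρ₂
        (by
          cases hsp : splitsSome x b H with
          | true => exact ⟨hinv.sub, hinv.ent, by simp, by simp, fun _ => j₁⟩
          | false =>
            refine ⟨hinv.sub, hinv.ent, by simp, fun _ => Or.inr ⟨j₁, ?_⟩, by simp⟩
            rw [(j₄ hsp).1]
            exact (j₄ hsp).2)
        (by
          cases hsp : splitsSome x b H with
          | true =>
            have := j₃ hsp
            simp only [sweepBound, if_true]
            omega
          | false =>
            have h₁ := j₁.card_sdiff
            have h₂ := Nat.mul_le_mul_right (n + 3) h₁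
            simp only [sweepBound, Bool.false_eq_true, if_false, reduceCtorEq]
            rw [Nat.add_mul] at h₂
            omega)
      refine ⟨k + 1, ans, by omega, hk₂, ?_⟩
      rw [run, hfin]
      exact hk₃
    | select =>
      obtain ⟨hρ₁, e₁⟩ := certain_select_goal (mixed := mixed) ρ hρ goal μ hph hf
      obtain ⟨hρ₂, p₂, b₂, d₂, c₂⟩ := certain_hyps (mixed := mixed) H _ hρ₁
        ((certainProgram mixed).atomStep (μ, ρ) goal).1 (by rw [e₁]; simp) (by rw [e₁])
      have es : (certainProgram mixed).sweep (goal :: H) (μ, ρ) =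
        (certainProgram mixed).sweep H (((certainProgram mixed).atomStep (μ, ρ) goal).1,
          ((certainProgram mixed).atomStep (μ, ρ) goal).2) := rfl
      rw [← es] at hρ₂ p₂ b₂ d₂ c₂
      rw [e₁] at p₂ b₂ d₂ c₂
      simp only [Bool.false_or] at p₂ b₂ d₂ c₂
      have hsel := hinv.select hph
      by_cases hbad : ∃ i ∈ b, i ∈ goal.Y
      · refine ⟨1, false, by omega, ?_, ?_⟩
        · rcases hsel with rfl | ⟨hB, hst⟩
          · simp at hbad
          · simpa using hB.not_implies h𝒟 hk hinv.sub hst hbad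
        · have : (certainProgram mixed).finish
              ((certainProgram mixed).sweep (goal :: H) (μ, ρ)).1 = .inr false := by
            rw [decide_eq_true hbad] at b₂
            simp only [certainProgram] at p₂ b₂ ⊢
            simp only [p₂, b₂, if_true]
          rw [run, this]
      -- the goal reduces to the left side without the final block
      have hent : Ent Val H (x \ b) goal.Y → Ent Val H goal.X goal.Y := by
        intro h
        refine hinv.ent ?_
        rcases hsel with rfl | ⟨hB, -⟩
        · simpa using h
        · intro D r hr
          refine Ind.of_sdiff (hconst D r hr) (hB.ent D r hr) ?_ (h D r hr)
          rw [Finset.disjoint_left]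
          exact fun i hi hiY => hbad ⟨i, hi, hiY⟩
      by_cases hdone : x \ b ⊆ constants H
      · refine ⟨1, true, by omega, ?_, ?_⟩
        · simp only [true_iff]
          refine (hent fun D r hr => Ind.of_constant fun i hi => ?_).implies hk 𝒟
          exact hconst D r hr i (hdone hi)
        · have : (certainProgram mixed).finish
              ((certainProgram mixed).sweep (goal :: H) (μ, ρ)).1 = .inr true := by
            rw [decide_eq_false hbad] at b₂
            rw [decide_eq_true hdone] at d₂
            simp only [certainProgram] at p₂ b₂ d₂ ⊢
            simp only [p₂, b₂, d₂, if_true, Bool.false_eq_true, if_false]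
          rw [run, this]
      have hB₀ : BlockInv Val H (x \ b) goal.Y ((x \ b ∪ goal.Y) \ constants H) := by
        refine ⟨Finset.sdiff_disjoint, Finset.sdiff_subset, ?_, ?_⟩
        · obtain ⟨i, hi, hiC⟩ := Finset.not_subset.1 hdone
          exact ⟨i, by simp_all⟩
        · rw [Finset.sdiff_self]
          exact fun D r _ => Ind.empty_right _ _
      obtain ⟨j₁, j₂, j₃, j₄⟩ := hB₀.foldl H (List.Subset.refl H)
      rw [hph] at hm
      simp only [sweepBound, reduceCtorEq, if_false] at hm
      have hfin : (certainProgram mixed).finish ((certainProgram mixed).sweep (goal :: H) (μ, ρ)).1 =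
          .inl { ((certainProgram mixed).sweep (goal :: H) (μ, ρ)).1 with
            phase := if splitsSome (x \ b) ((x \ b ∪ goal.Y) \ constants H) H then .refine
              else .select, fresh := true } := by
        rw [decide_eq_false hbad] at b₂
        rw [decide_eq_false hdone] at d₂
        simp only [certainProgram] at p₂ b₂ d₂ c₂ ⊢
        simp only [p₂, b₂, d₂, c₂, Bool.false_eq_true, if_false]
      have hcard : ((x \ b ∪ goal.Y) \ constants H).card ≤ n := by
        simpa using Finset.card_le_univ ((x \ b ∪ goal.Y) \ constants H)
      obtain ⟨k, ans, hk₁, hk₂, hk₃⟩ := ih (x \ b)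
        (H.foldl (refineBlock (x \ b)) ((x \ b ∪ goal.Y) \ constants H))
        { ((certainProgram mixed).sweep (goal :: H) (μ, ρ)).1 with
            phase := if splitsSome (x \ b) ((x \ b ∪ goal.Y) \ constants H) H then .refine
              else .select, fresh := true } rfl _ hρ₂
        (by
          have hsub := Finset.sdiff_subset.trans hinv.sub (a := x \ b)
          cases hsp : splitsSome (x \ b) ((x \ b ∪ goal.Y) \ constants H) H with
          | true => exact ⟨hsub, hent, by simp, by simp, fun _ => j₁⟩
          | false =>
            refine ⟨hsub, hent, by simp, fun _ => Or.inr ⟨j₁, ?_⟩, by simp⟩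
            rw [(j₄ hsp).1]
            exact (j₄ hsp).2)
        (by
          cases hsp : splitsSome (x \ b) ((x \ b ∪ goal.Y) \ constants H) H with
          | true =>
            simp only [sweepBound, if_true]
            omega
          | false =>
            have h₁ := j₁.card_sdiff
            have h₂ := Nat.mul_le_mul_right (n + 3) h₁
            simp only [sweepBound, Bool.false_eq_true, if_false, reduceCtorEq]
            rw [Nat.add_mul] at h₂
            omega)
      refine ⟨k + 1, ans, by omega, hk₂, ?_⟩
      rw [run, hfin]
      exact hk₃

/-- The class of inputs that the program accepts. -/
def certainClass (mixed : Bool) (I : Instance) : Prop :=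
  if mixed then IsDisjointMixedCIA I else IsCIA I

theorem certain_inPolynomialTime {Val : Type*} {𝒟 : Set (ℕ → Set Val)}
    (h𝒟 : ∃ D ∈ 𝒟, (∀ i, (D i).Nontrivial) ∧ ∀ i, (D i).Finite) (mixed : Bool) :
    InPolynomialTime (implicationLanguage 𝒟 (certainClass mixed)) := by
  refine (certainProgram mixed).inPolynomialTime _
    (fun w ⟨I, _, _, h⟩ => ⟨I, h.symm⟩) 3 fun I => ?_
  rw [encodeInstance_mem_implicationLanguage]
  obtain ⟨n, H, goal⟩ := I
  obtain ⟨hρ₁, p₁, f₁, b₁⟩ := certain_load_goal (mixed := mixed) (n := n)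
    (fun _ => (certainProgram mixed).blank) (by intro i; simp [certainProgram]) goal
    (certainProgram mixed).init rfl rfl
  obtain ⟨hρ₂, p₂, b₂⟩ := certain_load_hyps (mixed := mixed) H _ hρ₁
    ((certainProgram mixed).atomStep ((certainProgram mixed).init,
      fun _ => (certainProgram mixed).blank) goal).1 p₁ f₁
  have es : (certainProgram mixed).sweep (goal :: H) ((certainProgram mixed).init,
      fun _ => (certainProgram mixed).blank) = (certainProgram mixed).sweep H
        (((certainProgram mixed).atomStep ((certainProgram mixed).init,
      fun _ => (certainProgram mixed).blank) goal).1,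
        ((certainProgram mixed).atomStep ((certainProgram mixed).init,
      fun _ => (certainProgram mixed).blank) goal).2) := rfl
  rw [← es] at hρ₂ p₂ b₂
  rw [Finset.empty_union] at hρ₂
  generalize hs : (certainProgram mixed).sweep (goal :: H) ((certainProgram mixed).init,
      fun _ => (certainProgram mixed).blank) = s at hρ₂ p₂ b₂
  have hclass : s.1.bad = false ↔ certainClass mixed ⟨n, H, goal⟩ := by
    rw [b₂, b₁]
    cases mixed <;> simp [certainClass, IsCIA, IsDisjointMixedCIA] <;> tauto
  cases hb : s.1.bad with
  | true =>
    refine ⟨1, false, Nat.one_le_pow _ _ (by omega), ?_, ?_⟩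
    · simp only [Bool.false_eq_true, false_iff, not_and]
      intro h
      rw [← hclass, hb] at h
      simp at h
    · rw [run, hs]
      simp only [certainProgram] at p₂ ⊢
      simp only [p₂, hb, if_true]
  | false =>
    have hcl := hclass.1 hb
    have hk : goal.kind = .certain := (b₁.1 (b₂.1 hb).1).1
    have hC : ∀ a ∈ H, ∀ i, i ∈ a.X → i ∈ a.Y → a.kind = .certain := by
      intro a ha i hX hY
      have := (b₂.1 hb).2 a ha
      cases mixed
      · simpa using this
      · exact absurd hY (Finset.disjoint_left.1 (by simpa using this) hX)
    obtain ⟨k, ans, h₁, h₂, h₃⟩ := certain_run (mixed := mixed) h𝒟 hk hC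
      (sweepBound (constants H) .select goal.X ∅) goal.X ∅
      { s.1 with phase := .select, fresh := true } rfl s.2 hρ₂
      ⟨subset_rfl, id, by simp, fun _ => Or.inl rfl, by simp⟩ le_rfl
    refine ⟨k + 1, ans, ?_, ?_, ?_⟩
    · have hcard : ((goal.X \ ∅) \ constants H).card ≤ n := by
        simpa using Finset.card_le_univ ((goal.X \ ∅) \ constants H)
      simp only [sweepBound, reduceCtorEq, if_false] at h₁
      have := Nat.mul_le_mul_right (n + 3) hcard
      have e : (n + 3) ^ 3 = n * (n + 3) + (n + 4) + (n ^ 3 + 8 * n ^ 2 + 23 * n + 23) := by ring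
      change k + 1 ≤ (n + 3) ^ 3
      omega
    · rw [h₂]
      simp [hcl]
    · rw [run, hs]
      have : (certainProgram mixed).finish s.1 =
          .inl { s.1 with phase := .select, fresh := true } := by
        simp only [certainProgram] at p₂ ⊢
        simp only [p₂, hb, Bool.false_eq_true, if_false]
      rw [this]
      exact h₃

end CertainProgram

/-! ### The sweep program for possible goals -/

/-- The phases of the program for possible goals: reading the input into the cells, evaluating the
criterion, and comparing the sizes of the sides of the goal. -/
inductive PossiblePhase
  | load
  | eval
  | cancel
  deriving DecidableEq

instance : Fintype PossiblePhase where
  elems := {.load, .eval, .cancel}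
  complete p := by cases p <;> decide

/-- The mode of the program for possible goals. Here `bad` and `ok` record violations and the
validity of the criterion, and `fresh`, `goal` and `kind` are as for certain goals. While the sizes
are compared, `stage` counts the sweeps up to two, `gx` and `gy` tell whether elements of the two
sides were left at the start of the sweep, and `hx` and `hy` whether this was so in the preceding
sweep. -/
structure PossibleMode where
  phase : PossiblePhase
  fresh : Bool
  goal : Bool
  kind : Kind
  bad : Bool
  ok : Bool
  stage : Fin 3
  hx : Bool
  hy : Bool
  gx : Bool
  gy : Bool

/-- A cell of the program for possible goals: membership of the attribute in the two sides of the
goal, among the constants, and among the elements of the two sides that are left. -/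
structure PossibleCell where
  x : Bool
  y : Bool
  c : Bool
  p : Bool
  q : Bool

noncomputable instance : Fintype PossibleMode :=
  Fintype.ofInjective
    (fun μ => (μ.phase, μ.fresh, μ.goal, μ.kind, μ.bad, μ.ok, μ.stage, μ.hx, μ.hy, μ.gx, μ.gy) :
      PossibleMode → PossiblePhase × Bool × Bool × Kind × Bool × Bool × Fin 3 × Bool × Bool ×
        Bool × Bool)
    (by rintro ⟨⟩ ⟨⟩ h; simpa using h)

noncomputable instance : Fintype PossibleCell :=
  Fintype.ofInjective
    (fun c => (c.x, c.y, c.c, c.p, c.q) : PossibleCell → Bool × Bool × Bool × Bool × Bool)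
    (by rintro ⟨⟩ ⟨⟩ h; simpa using h)

/-- The program for possible goals. It evaluates the criterion for the implication in one sweep and
then compares the sizes of the sides of the goal, removing the first element of both sides in each
sweep. -/
def possibleProgram : SweepProgram PossibleMode PossibleCell where
  init := ⟨.load, true, false, .certain, false, false, 0, true, true, false, false⟩
  blank := ⟨false, false, false, false, false⟩
  start μ k := { μ with fresh := false, goal := μ.fresh, kind := k }
  test μ c v w :=
    match μ.phase, μ.goal with
    | .eval, true => ![c.x && c.y && !c.c, c.x && !c.c, c.y && !c.c, false]
    | .eval, false =>
      ![c.x && !c.c && !v, c.y && !c.c && !w, c.x && !c.c && !w, c.y && !c.c && !v]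
    | .cancel, true => ![c.p, c.q, false, false]
    | _, _ => ![false, false, false, false]
  write μ fl c v w :=
    match μ.phase, μ.goal with
    | .load, true => { c with x := v, y := w, p := v, q := w }
    | .load, false => { c with c := c.c || (v && w) }
    | .cancel, true => { c with p := c.p && fl 0, q := c.q && fl 1 }
    | _, _ => c
  settle μ fl :=
    match μ.phase, μ.goal with
    | .load, _ => { μ with bad := μ.bad || decide (μ.kind ≠ .possible) }
    | .eval, true => { μ with bad := fl 0, ok := !fl 1 || !fl 2 }
    | .eval, false => { μ with ok := μ.ok || (!fl 0 && !fl 1) || (!fl 2 && !fl 3) }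
    | .cancel, true => { μ with gx := fl 0, gy := fl 1 }
    | .cancel, false => μ
  update _ _ c := c
  finish μ :=
    match μ.phase with
    | .load => if μ.bad then .inr false else .inl { μ with phase := .eval, fresh := true }
    | .eval =>
      if !μ.bad && μ.ok then
        .inl { μ with phase := .cancel, fresh := true, stage := 0, hx := true, hy := true }
      else .inr false
    | .cancel =>
      if !μ.gx && !μ.gy then .inr true
      else if μ.stage = 1 ∧ ((μ.hx && !μ.gx) || (μ.hy && !μ.gy)) = true then .inr true
      else if μ.gx ≠ μ.gy ∧ μ.hx ≠ μ.hy then .inr false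
      else .inl { μ with fresh := true, hx := μ.gx, hy := μ.gy,
                         stage := if μ.stage = 0 then 1 else 2 }

section PossibleProgram

variable {n : ℕ}

/-- The cells hold the given sets. -/
def PossibleRep (ρ : Fin n → PossibleCell) (x y C p q : Finset (Fin n)) : Prop :=
  ∀ i, (ρ i).x = decide (i ∈ x) ∧ (ρ i).y = decide (i ∈ y) ∧ (ρ i).c = decide (i ∈ C) ∧
    (ρ i).p = decide (i ∈ p) ∧ (ρ i).q = decide (i ∈ q)

variable {x y C p q : Finset (Fin n)}

theorem possible_load_goal (ρ : Fin n → PossibleCell) (hρ : PossibleRep ρ ∅ ∅ ∅ ∅ ∅) (a : Atom n)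
    (μ : PossibleMode) (hμ : μ.phase = .load) (hf : μ.fresh = true) :
    PossibleRep (possibleProgram.atomStep (μ, ρ) a).2 a.X a.Y ∅ a.X a.Y ∧
    (possibleProgram.atomStep (μ, ρ) a).1.phase = .load ∧
    (possibleProgram.atomStep (μ, ρ) a).1.fresh = false ∧
    ((possibleProgram.atomStep (μ, ρ) a).1.bad = false ↔ μ.bad = false ∧ a.kind = .possible) := by
  obtain ⟨ph, fr, go, k, ba, ok, st, hx, hy, gx, gy⟩ := μ
  subst hμ hf
  refine ⟨fun i => ?_, rfl, rfl, ?_⟩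
  · have := hρ i
    simp_all [atomStep, possibleProgram, bits]
  · simp [atomStep, possibleProgram]

theorem possible_load_hyps (H : List (Atom n)) (ρ : Fin n → PossibleCell)
    (hρ : PossibleRep ρ x y C p q) (μ : PossibleMode) (hμ : μ.phase = .load)
    (hf : μ.fresh = false) :
    PossibleRep (possibleProgram.sweep H (μ, ρ)).2 x y (C ∪ constants H) p q ∧
    (possibleProgram.sweep H (μ, ρ)).1.phase = .load ∧
    ((possibleProgram.sweep H (μ, ρ)).1.bad = false ↔ μ.bad = false ∧
      ∀ a ∈ H, a.kind = .possible) := by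
  induction H generalizing ρ μ C with
  | nil =>
    refine ⟨?_, hμ, by simp [sweep]⟩
    have : constants ([] : List (Atom n)) = ∅ := by ext; simp [mem_constants]
    rw [this, Finset.union_empty]
    exact hρ
  | cons a H ih =>
    obtain ⟨ph, fr, go, k, ba, ok, st, hx, hy, gx, gy⟩ := μ
    subst hμ hf
    have h₁ : PossibleRep (possibleProgram.atomStep
        (⟨.load, false, go, k, ba, ok, st, hx, hy, gx, gy⟩, ρ) a).2 x y (C ∪ (a.X ∩ a.Y)) p q := by
      intro i
      have := hρ i
      simp_all [atomStep, possibleProgram, bits]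
    obtain ⟨i₁, i₂, i₃⟩ := ih _ h₁ (possibleProgram.atomStep
        (⟨.load, false, go, k, ba, ok, st, hx, hy, gx, gy⟩, ρ) a).1 rfl rfl
    have e : C ∪ (a.X ∩ a.Y) ∪ constants H = C ∪ constants (a :: H) := by
      ext i
      simp [mem_constants]
    rw [e] at i₁
    refine ⟨i₁, i₂, i₃.trans ?_⟩
    simp [atomStep, possibleProgram, and_assoc]

theorem possible_eval_goal (ρ : Fin n → PossibleCell) (hρ : PossibleRep ρ x y C p q) (a : Atom n)
    (μ : PossibleMode) (hμ : μ.phase = .eval) (hf : μ.fresh = true) :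
    PossibleRep (possibleProgram.atomStep (μ, ρ) a).2 x y C p q ∧
    (possibleProgram.atomStep (μ, ρ) a).1.phase = .eval ∧
    (possibleProgram.atomStep (μ, ρ) a).1.fresh = false ∧
    ((possibleProgram.atomStep (μ, ρ) a).1.bad = false ↔ ∀ i ∈ x, i ∈ y → i ∈ C) ∧
    ((possibleProgram.atomStep (μ, ρ) a).1.ok = true ↔ x ⊆ C ∨ y ⊆ C) := by
  obtain ⟨ph, fr, go, k, ba, ok, st, hx, hy, gx, gy⟩ := μ
  subst hμ hf
  have hx : ∀ i, (ρ i).x = decide (i ∈ x) := fun i => (hρ i).1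
  have hy : ∀ i, (ρ i).y = decide (i ∈ y) := fun i => (hρ i).2.1
  have hc : ∀ i, (ρ i).c = decide (i ∈ C) := fun i => (hρ i).2.2.1
  refine ⟨hρ, rfl, rfl, ?_, ?_⟩
  · simp [atomStep, possibleProgram, flagsBelow_all, hx, hy, hc]
  · simp [atomStep, possibleProgram, flagsBelow_all, hx, hy, hc, Finset.subset_iff]

theorem possible_eval_hyps (H : List (Atom n)) (ρ : Fin n → PossibleCell)
    (hρ : PossibleRep ρ x y C p q) (μ : PossibleMode) (hμ : μ.phase = .eval)
    (hf : μ.fresh = false) :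
    PossibleRep (possibleProgram.sweep H (μ, ρ)).2 x y C p q ∧
    (possibleProgram.sweep H (μ, ρ)).1.phase = .eval ∧
    (possibleProgram.sweep H (μ, ρ)).1.bad = μ.bad ∧
    ((possibleProgram.sweep H (μ, ρ)).1.ok = true ↔ μ.ok = true ∨ ∃ a ∈ H, Covers C a x y) := by
  induction H generalizing μ ρ with
  | nil => exact ⟨hρ, hμ, rfl, by simp [sweep]⟩
  | cons a H ih =>
    obtain ⟨ph, fr, go, k, ba, ok, st, hx, hy, gx, gy⟩ := μ
    subst hμ hf
    obtain ⟨i₁, i₂, i₃, i₄⟩ := ih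
      (possibleProgram.atomStep (⟨.eval, false, go, k, ba, ok, st, hx, hy, gx, gy⟩, ρ) a).2 hρ
      (possibleProgram.atomStep (⟨.eval, false, go, k, ba, ok, st, hx, hy, gx, gy⟩, ρ) a).1 rfl rfl
    refine ⟨i₁, i₂, i₃, i₄.trans ?_⟩
    have ex : ∀ i, (ρ i).x = decide (i ∈ x) := fun i => (hρ i).1
    have ey : ∀ i, (ρ i).y = decide (i ∈ y) := fun i => (hρ i).2.1
    have ec : ∀ i, (ρ i).c = decide (i ∈ C) := fun i => (hρ i).2.2.1
    have hsub : ∀ s t : Finset (Fin n), s ⊆ t ∪ C ↔ ∀ i, i ∈ s → i ∉ C → i ∈ t := by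
      intro s t
      simp only [Finset.subset_iff, Finset.mem_union]
      exact forall_congr' fun i => by tauto
    have : (possibleProgram.atomStep
        (⟨.eval, false, go, k, ba, ok, st, hx, hy, gx, gy⟩, ρ) a).1.ok = true ↔
        ok = true ∨ Covers C a x y := by
      simp [atomStep, possibleProgram, flagsBelow_all, ex, ey, ec, bits, Covers, hsub, or_assoc]
    rw [this]
    simp [or_assoc]

/-- Keeping the elements that have a smaller one removes the least element. -/
theorem card_filter_exists_lt (p : Finset (Fin n)) :
    (p.filter fun i => ∃ j, j.val < i.val ∧ j ∈ p).card = p.card - 1 := by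
  rcases p.eq_empty_or_nonempty with rfl | hp
  · simp
  · have : (p.filter fun i => ∃ j, j.val < i.val ∧ j ∈ p) = p.erase (p.min' hp) := by
      ext i
      simp only [Finset.mem_filter, Finset.mem_erase]
      constructor
      · rintro ⟨hi, j, hj, hjp⟩
        exact ⟨fun e => absurd (p.min'_le j hjp) (not_le.2 (e ▸ hj)), hi⟩
      · rintro ⟨hne, hi⟩
        exact ⟨hi, p.min' hp, lt_of_le_of_ne (p.min'_le i hi) (fun e => hne (Fin.ext e.symm)), p.min'_mem hp⟩
    rw [this, Finset.card_erase_of_mem (p.min'_mem hp)]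

theorem possible_cancel_goal (ρ : Fin n → PossibleCell) (hρ : PossibleRep ρ x y C p q) (a : Atom n)
    (μ : PossibleMode) (hμ : μ.phase = .cancel) (hf : μ.fresh = true) :
    ∃ p' q' : Finset (Fin n), p'.card = p.card - 1 ∧ q'.card = q.card - 1 ∧
    PossibleRep (possibleProgram.atomStep (μ, ρ) a).2 x y C p' q' ∧
    (possibleProgram.atomStep (μ, ρ) a).1 =
      { μ with fresh := false, goal := true, kind := a.kind, gx := decide (0 < p.card),
               gy := decide (0 < q.card) } := by
  obtain ⟨ph, fr, go, k, ba, ok, st, hx, hy, gx, gy⟩ := μ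
  subst hμ hf
  refine ⟨_, _, card_filter_exists_lt p, card_filter_exists_lt q, ?_, ?_⟩
  · have hp : ∀ i, (ρ i).p = decide (i ∈ p) := fun i => (hρ i).2.2.2.1
    have hq : ∀ i, (ρ i).q = decide (i ∈ q) := fun i => (hρ i).2.2.2.2
    intro i
    obtain ⟨h₁, h₂, h₃, -, -⟩ := hρ i
    simp [atomStep, possibleProgram, flagsBelow, h₁, h₂, h₃, hp, hq]
  · have hp : ∀ i, (ρ i).p = decide (i ∈ p) := fun i => (hρ i).2.2.2.1
    have hq : ∀ i, (ρ i).q = decide (i ∈ q) := fun i => (hρ i).2.2.2.2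
    simp [atomStep, possibleProgram, flagsBelow_all, hp, hq, Finset.card_pos, Finset.Nonempty]

theorem possible_cancel_hyps (H : List (Atom n)) (ρ : Fin n → PossibleCell) (μ : PossibleMode)
    (hμ : μ.phase = .cancel) (hf : μ.fresh = false) :
    (possibleProgram.sweep H (μ, ρ)).2 = ρ ∧
    ∃ g k, (possibleProgram.sweep H (μ, ρ)).1 = { μ with goal := g, kind := k } := by
  induction H generalizing μ with
  | nil => exact ⟨rfl, μ.goal, μ.kind, rfl⟩
  | cons a H ih =>
    obtain ⟨ph, fr, go, k, ba, ok, st, hx, hy, gx, gy⟩ := μ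
    subst hμ hf
    exact ih ⟨.cancel, false, false, a.kind, ba, ok, st, hx, hy, gx, gy⟩ rfl rfl

set_option maxHeartbeats 1000000 in
/-- The comparison of the sizes `A` and `B` of the sides of the goal, after `j` sweeps. The next
sweep finds elements left on the left side if and only if `j < A`. If both sides are exhausted now,
then their sizes differ by at most one, because neither was exhausted two sweeps earlier than the
other; a nonempty side that is exhausted after the first sweep has size one; and if only one side is
exhausted both now and in the preceding sweep, then the sizes differ by two or more. -/
theorem possible_run_cancel (H : List (Atom n)) (goal : Atom n) (A B m j : ℕ) (hm : A + B ≤ m + j)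
    (μ : PossibleMode) (hμ : μ.phase = .cancel) (hf : μ.fresh = true) (ρ : Fin n → PossibleCell)
    (x y C p q : Finset (Fin n)) (hρ : PossibleRep ρ x y C p q)
    (hp : p.card = A - j) (hq : q.card = B - j)
    (hx : μ.hx = decide (j = 0 ∨ j ≤ A)) (hy : μ.hy = decide (j = 0 ∨ j ≤ B))
    (hA : j ≤ A + 1) (hB : j ≤ B + 1) (hstage : μ.stage.val = min j 2)
    (hone : 2 ≤ j → A ≠ 1 ∧ B ≠ 1) :
    ∃ (k : ℕ) (ans : Bool), k ≤ m + 1 ∧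
      (ans = true ↔ (A = 1 ∨ B = 1) ∨ |(A : ℤ) - (B : ℤ)| ≤ 1) ∧
      possibleProgram.run (goal :: H) k (μ, ρ) = some ans := by
  induction m using Nat.strong_induction_on generalizing j μ ρ p q with
  | _ m ih =>
  obtain ⟨p', q', hp', hq', hρ₁, e₁⟩ := possible_cancel_goal ρ hρ goal μ hμ hf
  obtain ⟨hρ₂, g, k₀, e₂⟩ := possible_cancel_hyps H (possibleProgram.atomStep (μ, ρ) goal).2
    (possibleProgram.atomStep (μ, ρ) goal).1 (by rw [e₁]; exact hμ) (by rw [e₁])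
  have es : possibleProgram.sweep (goal :: H) (μ, ρ) = possibleProgram.sweep H
      ((possibleProgram.atomStep (μ, ρ) goal).1, (possibleProgram.atomStep (μ, ρ) goal).2) := rfl
  rw [← es] at hρ₂ e₂
  rw [e₁] at e₂
  rw [← hρ₂] at hρ₁
  have eA : decide (0 < p.card) = decide (j < A) := by rw [hp]; congr 1; rw [eq_iff_iff]; omega
  have eB : decide (0 < q.card) = decide (j < B) := by rw [hq]; congr 1; rw [eq_iff_iff]; omega
  rw [eA, eB] at e₂
  simp only at e₂
  generalize hs : possibleProgram.sweep (goal :: H) (μ, ρ) = s at *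
  obtain ⟨μ₁, ρ₁⟩ := s
  simp only at e₂ hρ₁
  subst e₂
  obtain ⟨ph, fr, go, k₁, ba, ok, st, hx', hy', gx, gy⟩ := μ
  simp only at hμ hf hx hy hstage hs
  subst hμ hf hx hy
  have habs : |(A : ℤ) - (B : ℤ)| ≤ 1 ↔ A ≤ B + 1 ∧ B ≤ A + 1 := by
    rw [abs_le]; omega
  have hst1 : st = 1 ↔ j = 1 := by
    rw [Fin.ext_iff, hstage]; simp; omega
  have hst0 : st = 0 ↔ j = 0 := by
    rw [Fin.ext_iff, hstage]; simp
  have hfin : possibleProgram.finish ⟨.cancel, false, g, k₀, ba, ok, st, decide (j = 0 ∨ j ≤ A),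
      decide (j = 0 ∨ j ≤ B), decide (j < A), decide (j < B)⟩ =
      if ¬ j < A ∧ ¬ j < B then .inr true
      else if j = 1 ∧ ((j = 0 ∨ j ≤ A) ∧ ¬ j < A ∨ (j = 0 ∨ j ≤ B) ∧ ¬ j < B) then .inr true
      else if ¬ (j < A ↔ j < B) ∧ ¬ (j = 0 ∨ j ≤ A ↔ j = 0 ∨ j ≤ B) then .inr false
      else .inl ⟨.cancel, true, g, k₀, ba, ok, if j = 0 then 1 else 2, decide (j < A),
        decide (j < B), decide (j < A), decide (j < B)⟩ := by
    simp only [possibleProgram, Bool.and_eq_true, Bool.or_eq_true, Bool.not_eq_true',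
      decide_eq_true_eq, decide_eq_false_iff_not, ne_eq, decide_eq_decide, hst1, hst0]
  rw [habs]
  by_cases h₁ : ¬ j < A ∧ ¬ j < B
  · refine ⟨1, true, by omega, ?_, ?_⟩
    · simp only [true_iff]; omega
    · rw [run, hs, hfin, if_pos h₁]
  by_cases h₂ : j = 1 ∧ ((j = 0 ∨ j ≤ A) ∧ ¬ j < A ∨ (j = 0 ∨ j ≤ B) ∧ ¬ j < B)
  · refine ⟨1, true, by omega, ?_, ?_⟩
    · simp only [true_iff]; omega
    · rw [run, hs, hfin, if_neg h₁, if_pos h₂]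
  by_cases h₃ : ¬ (j < A ↔ j < B) ∧ ¬ (j = 0 ∨ j ≤ A ↔ j = 0 ∨ j ≤ B)
  · refine ⟨1, false, by omega, ?_, ?_⟩
    · simp only [Bool.false_eq_true, false_iff]; omega
    · rw [run, hs, hfin, if_neg h₁, if_neg h₂, if_pos h₃]
  · have hm1 : 1 ≤ m := by omega
    have c₁ : p'.card = A - (j + 1) := by rw [hp', hp, Nat.sub_sub]
    have c₂ : q'.card = B - (j + 1) := by rw [hq', hq, Nat.sub_sub]
    have c₃ : j + 1 ≤ A + 1 ∧ j + 1 ≤ B + 1 := by clear hone hstage; omega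
    have c₄ : 2 ≤ j + 1 → A ≠ 1 ∧ B ≠ 1 := by omega
    have c₅ : (if j = 0 then (1 : Fin 3) else 2).val = min (j + 1) 2 := by
      split_ifs with h
      · simp [h]
      · rw [min_eq_right (by omega)]; rfl
    have c₆ : ∀ D, decide (j < D) = decide (j + 1 = 0 ∨ j + 1 ≤ D) := by
      intro D; simp
    have c₇ : A + B ≤ m - 1 + (j + 1) := by clear h₁ h₂ h₃ hone; omega
    obtain ⟨k, ans, i₁, i₂, i₃⟩ := ih (m - 1) (Nat.sub_lt hm1 one_pos) (j + 1) c₇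
      ⟨.cancel, true, g, k₀, ba, ok, if j = 0 then 1 else 2, decide (j < A), decide (j < B),
        decide (j < A), decide (j < B)⟩ rfl rfl ρ₁ p' q' hρ₁ c₁ c₂ (c₆ A) (c₆ B) c₃.1 c₃.2 c₅ c₄
    rw [habs] at i₂
    refine ⟨k + 1, ans, by omega, i₂, ?_⟩
    rw [run, hs, hfin, if_neg h₁, if_neg h₂, if_neg h₃]
    exact i₃

/-- The criterion holds for all possible goals; the program rejects goals outside `PIA*` only since
they do not belong to the inputs of the problem. -/
theorem possible_inPolynomialTime {Val : Type*} {𝒟 : Set (ℕ → Set Val)}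
    (h_two : ∀ D ∈ 𝒟, ∀ i, (D i).Nontrivial) (h𝒟 : 𝒟.Nonempty) :
    InPolynomialTime (implicationLanguage 𝒟 IsPIAPIAStar) := by
  refine possibleProgram.inPolynomialTime _ (fun w ⟨I, _, _, h⟩ => ⟨I, h.symm⟩) 4 fun I => ?_
  rw [encodeInstance_mem_implicationLanguage]
  obtain ⟨n, H, goal⟩ := I
  -- the first sweep
  obtain ⟨hρ₁, p₁, f₁, b₁⟩ := possible_load_goal (n := n) (fun _ => possibleProgram.blank)
    (by intro i; simp [possibleProgram]) goal possibleProgram.init rfl rfl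
  obtain ⟨hρ₂, p₂, b₂⟩ := possible_load_hyps H _ hρ₁ (possibleProgram.atomStep
    (possibleProgram.init, fun _ => possibleProgram.blank) goal).1 p₁ f₁
  have es : possibleProgram.sweep H ((possibleProgram.atomStep
      (possibleProgram.init, fun _ => possibleProgram.blank) goal).1, (possibleProgram.atomStep
      (possibleProgram.init, fun _ => possibleProgram.blank) goal).2) =
      possibleProgram.sweep (goal :: H) (possibleProgram.init, fun _ => possibleProgram.blank) :=
    rfl
  rw [es] at hρ₂ p₂ b₂
  rw [Finset.empty_union] at hρ₂
  rw [b₁] at b₂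
  generalize hs : possibleProgram.sweep (goal :: H)
    (possibleProgram.init, fun _ => possibleProgram.blank) = s at hρ₂ p₂ b₂
  cases hb : s.1.bad with
  | true =>
    refine ⟨1, false, Nat.one_le_pow _ _ (by omega), ?_, ?_⟩
    · simp only [Bool.false_eq_true, false_iff, not_and]
      rintro ⟨h₁, h₂, -⟩
      have := b₂.2 ⟨⟨rfl, h₂⟩, h₁⟩
      rw [hb] at this
      simp at this
    · rw [run, hs]
      simp only [possibleProgram] at p₂ ⊢
      simp only [p₂, hb, if_true]
  | false =>
  obtain ⟨⟨-, hk⟩, hH⟩ := b₂.1 hb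
  have hfin₁ : possibleProgram.finish s.1 = .inl { s.1 with phase := .eval, fresh := true } := by
    simp only [possibleProgram] at p₂ ⊢
    simp only [p₂, hb, Bool.false_eq_true, if_false]
  -- the second sweep
  obtain ⟨hρ₃, p₃, f₃, b₃, o₃⟩ := possible_eval_goal s.2 hρ₂ goal
    { s.1 with phase := .eval, fresh := true } rfl rfl
  obtain ⟨hρ₄, p₄, b₄, o₄⟩ := possible_eval_hyps H _ hρ₃ (possibleProgram.atomStep
    ({ s.1 with phase := .eval, fresh := true }, s.2) goal).1 p₃ f₃
  have es' : possibleProgram.sweep H ((possibleProgram.atomStep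
      ({ s.1 with phase := .eval, fresh := true }, s.2) goal).1, (possibleProgram.atomStep
      ({ s.1 with phase := .eval, fresh := true }, s.2) goal).2) =
      possibleProgram.sweep (goal :: H) ({ s.1 with phase := .eval, fresh := true }, s.2) := rfl
  rw [es'] at hρ₄ p₄ b₄ o₄
  generalize hs' : possibleProgram.sweep (goal :: H)
    ({ s.1 with phase := .eval, fresh := true }, s.2) = s' at hρ₄ p₄ b₄ o₄
  rw [← b₄] at b₃
  rw [o₃] at o₄
  have hcrit : (s'.1.bad = false ∧ s'.1.ok = true) ↔ Implies 𝒟 H goal := by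
    rw [implies_possible_iff h_two h𝒟 hH hk, PossibleCriterion, b₃, o₄, or_assoc]
  by_cases hc : s'.1.bad = false ∧ s'.1.ok = true
  · have hfin₂ : possibleProgram.finish s'.1 = .inl { s'.1 with
        phase := .cancel, fresh := true, stage := 0, hx := true, hy := true } := by
      simp only [possibleProgram] at p₄ hc ⊢
      simp only [p₄, hc, Bool.not_false, Bool.and_self, if_true]
    obtain ⟨k, ans, h₁, h₂, h₃⟩ := possible_run_cancel H goal goal.X.card goal.Y.card
      (goal.X.card + goal.Y.card) 0 le_rfl { s'.1 with
        phase := .cancel, fresh := true, stage := 0, hx := true, hy := true } rfl rfl s'.2 _ _ _ _ _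
      hρ₄ rfl rfl (by simp) (by simp) (by omega) (by omega) (by simp) (by omega)
    refine ⟨k + 2, ans, ?_, ?_, ?_⟩
    · have hX : goal.X.card ≤ n := by simpa using Finset.card_le_univ goal.X
      have hY : goal.Y.card ≤ n := by simpa using Finset.card_le_univ goal.Y
      have e : (n + 4) ^ 4 = (2 * n + 3) + (n ^ 4 + 16 * n ^ 3 + 96 * n ^ 2 + 254 * n + 253) := by
        ring
      change k + 2 ≤ (n + 4) ^ 4
      omega
    · rw [h₂]
      simp [IsPIAPIAStar, Atom.IsPIAStar, hk, hcrit.1 hc]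
      exact fun _ => hH
    · rw [run, hs, hfin₁]
      simp only
      rw [run, hs', hfin₂]
      exact h₃
  · refine ⟨2, false, ?_, ?_, ?_⟩
    · change 2 ≤ (n + 4) ^ 4
      exact le_trans (by norm_num) (Nat.pow_le_pow_left (show 4 ≤ n + 4 by omega) 4)
    · simp only [Bool.false_eq_true, false_iff, not_and]
      intro _ h
      exact hc (hcrit.2 h)
    · have hfin₂ : possibleProgram.finish s'.1 = .inr false := by
        have : (!s'.1.bad && s'.1.ok) = false := by
          cases h₁ : s'.1.bad <;> cases h₂ : s'.1.ok <;> simp_all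
        simp only [possibleProgram] at p₄ ⊢
        simp only [p₄, this, Bool.false_eq_true, if_false]
      rw [run, hs, hfin₁]
      simp only
      rw [run, hs', hfin₂]

end PossibleProgram

end IncompleteIndependence

theorem mainTheorem10 {Val : Type*} (𝒟 : Set (ℕ → Set Val))
    (h_two : ∀ D ∈ 𝒟, ∀ i, (D i).Nontrivial)
    (h_fin : ∃ D ∈ 𝒟, ∀ i, (D i).Finite) :
    IncompleteIndependence.InPolynomialTime
        (IncompleteIndependence.implicationLanguage 𝒟 IncompleteIndependence.IsCIA) ∧
      IncompleteIndependence.InPolynomialTime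
        (IncompleteIndependence.implicationLanguage 𝒟 IncompleteIndependence.IsPIAPIAStar) ∧
      IncompleteIndependence.InPolynomialTime
        (IncompleteIndependence.implicationLanguage 𝒟
          IncompleteIndependence.IsDisjointMixedCIA) := by
  obtain ⟨D, hD, hDfin⟩ := h_fin
  have h𝒟 : ∃ D ∈ 𝒟, (∀ i, (D i).Nontrivial) ∧ ∀ i, (D i).Finite := ⟨D, hD, h_two D hD, hDfin⟩
  exact ⟨IncompleteIndependence.certain_inPolynomialTime h𝒟 false,
    IncompleteIndependence.possible_inPolynomialTime h_two ⟨D, hD⟩,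
    IncompleteIndependence.certain_inPolynomialTime h𝒟 true⟩
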